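/- Let $\Bbbk$ be an algebraically closed field. All modules are right modules. For $n>1$ let $A_n$ be the zig-zag algebra of type $A$: the quotient of the path algebra over $\Bbbk$ of the quiver with vertices $1,\dots,n$ and arrows $i\to i+1$, $i+1\to i$ ($1\le i<n$) by the ideal generated by all paths of length three, all paths of length two that are not cycles, and all differences of two cycles of length two at the same vertex. Let $B_n$ be the quotient of $A_n$ by the cycle of length two at the vertex $n$. Let $\Lambda$ be a finite-dimensional $\Bbbk$-algebra that is basic and connected, let $L_1<L_2<\dots<L_n$, $n\geq 1$, be a full ordered list of representatives of the isomorphism classes of simple $\Lambda$-modules, and let $P_i$ be the projective cover of $L_i$. Suppose that $\Lambda$ is quasi-hereditary with respect to this order, i.e. there are $\Lambda$-modules $\Delta_1,\dots,\Delta_n$ such that for every $i$ there is a surjection $P_i\twoheadrightarrow\Delta_i$ whose kernel has a finite filtration with subquotients isomorphic to modules $\Delta_j$, $j>i$, and a surjection $\Delta_i\twoheadrightarrow L_i$ all of whose kernel's composition factors are isomorphic to modules $L_j$, $j<i$. Assume the following: (a) Exactly $n-1$ of the indecomposable projective $\Lambda$-modules $P_1,\dots,P_n$ are injective. (b) $\Lambda$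 has a simple preserving duality, i.e. there is a contravariant autoequivalence $\star$ of the category of finite-dimensional $\Lambda$-modules such that $\star\circ\star$ is naturally isomorphic to the identity functor and $L^\star\cong L$ for every simple module $L$. Then $n>1$ and $\Lambda\cong B_n$ as $\Bbbk$-algebras. -/

import Mathlib

open CategoryTheory

universe u v w

/-! ### Modules -/

/-- `M` has a finite filtration `0 = N 0 ≤ N 1 ≤ ⋯ ≤ N m = M` by submodules, all of whose
subquotients are isomorphic to members of `S`. If all members of `S` are simple, this says
that `M` has finite length and that its composition subquotients belong to `S`. -/
def HasFiltration {R : Type u} [Ring R] (S : Set (ModuleCat.{v} R))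
    (M : Type w) [AddCommGroup M] [Module R M] : Prop :=
  ∃ (m : ℕ) (N : Fin (m + 1) → Submodule R M),
    N 0 = ⊥ ∧ N (Fin.last m) = ⊤ ∧
    ∀ t : Fin m, N t.castSucc ≤ N t.succ ∧
      ∃ X ∈ S, Nonempty ((N t.succ ⧸ (N t.castSucc).submoduleOf (N t.succ)) ≃ₗ[R] X)

/-- `P` is a projective cover of `L`: it is projective and surjects onto `L` with
superfluous kernel. -/
def IsProjectiveCover {R : Type u} [Ring R] (P L : ModuleCat.{v} R) : Prop :=
  Module.Projective R P ∧
    ∃ p : P →ₗ[R] L, Function.Surjective p ∧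
      ∀ N : Submodule R P, N ⊔ LinearMap.ker p = ⊤ → N = ⊤

/-- `L 0, …, L (n - 1)` is a full set of representatives of the isomorphism classes of simple
`R`-modules, without repetitions. -/
structure IsFullSetOfSimples {R : Type u} [Ring R] {n : ℕ} (L : Fin n → ModuleCat.{v} R) :
    Prop where
  simple : ∀ i, IsSimpleModule R (L i)
  not_iso : ∀ i j, i ≠ j → IsEmpty (L i ≃ₗ[R] L j)
  exists_iso : ∀ S : ModuleCat.{v} R, IsSimpleModule R S → ∃ i, Nonempty (S ≃ₗ[R] L i)

/-- Given a full list of simple modules `L 0 < L 1 < ⋯ < L (n - 1)`, ordered by the index, and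
their projective covers `P i`, there are standard modules `Δ i` such that
* `P i` surjects onto `Δ i` with kernel filtered by modules `Δ j` with `j > i`;
* `Δ i` surjects onto `L i` with kernel having composition subquotients `L j` with `j < i`. -/
def IsQuasiHereditary {R : Type u} [Ring R] {n : ℕ} (L P : Fin n → ModuleCat.{v} R) : Prop :=
  ∃ Δ : Fin n → ModuleCat.{v} R,
    (∀ i, ∃ p : P i →ₗ[R] Δ i, Function.Surjective p ∧
      HasFiltration {X | ∃ j, i < j ∧ X = Δ j} (LinearMap.ker p)) ∧
    (∀ i, ∃ q : Δ i →ₗ[R] L i, Function.Surjective q ∧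
      HasFiltration {X | ∃ j, j < i ∧ X = L j} (LinearMap.ker q))

/-- The category of finitely generated `R`-modules has a simple preserving duality: an
involutive contravariant autoequivalence which preserves the isomorphism classes of simple
modules. -/
def HasSimplePreservingDuality (R : Type u) [Ring R] : Prop :=
  ∃ F : (FGModuleCat.{u} R)ᵒᵖ ⥤ FGModuleCat.{u} R,
    F.IsEquivalence ∧
    Nonempty (F.rightOp ⋙ F ≅ 𝟭 (FGModuleCat.{u} R)) ∧
    ∀ S : FGModuleCat.{u} R, IsSimpleModule R S → Nonempty (F.obj (Opposite.op S) ≅ S)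

/-! ### Basic and connected algebras -/

/-- A primitive idempotent: a nonzero idempotent which is not the sum of two nonzero
orthogonal idempotents. -/
def IsPrimitiveIdem {A : Type u} [Ring A] (e : A) : Prop :=
  IsIdempotentElem e ∧ e ≠ 0 ∧
    ∀ f g : A, IsIdempotentElem f → IsIdempotentElem g → f * g = 0 → g * f = 0 →
      e = f + g → f = 0 ∨ g = 0

/-- `A` is basic: `1` is a sum of pairwise orthogonal primitive idempotents `e i` for which the
right modules `e i A` are pairwise non-isomorphic. -/
def IsBasicAlg (A : Type u) [Ring A] : Prop :=
  ∃ (m : ℕ) (e : Fin m → A), CompleteOrthogonalIdempotents e ∧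
    (∀ i, IsPrimitiveIdem (e i)) ∧
    ∀ i j, i ≠ j →
      IsEmpty (Submodule.span Aᵐᵒᵖ {e i} ≃ₗ[Aᵐᵒᵖ] Submodule.span Aᵐᵒᵖ {e j})

/-- `A` is connected: it is nonzero and not a product of two nonzero algebras, that is, its
only central idempotents are `0` and `1`. -/
def IsConnectedAlg (A : Type u) [Ring A] : Prop :=
  Nontrivial A ∧
    ∀ e : A, IsIdempotentElem e → (∀ x, e * x = x * e) → e = 0 ∨ e = 1

/-! ### Path algebras -/

/-- Generators of the path algebra of a quiver: vertices (trivial paths) and arrows. -/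
inductive PathGen (V : Type u) [Quiver.{v} V] : Type (max u v)
  | vertex (a : V) : PathGen V
  | arrow {a b : V} (f : a ⟶ b) : PathGen V

/-- Defining relations of the path algebra of a quiver with finitely many vertices: the trivial
paths are orthogonal idempotents with sum `1`, and `e_a f = f = f e_b` for an arrow
`f : a ⟶ b`. Paths are multiplied by concatenation, from left to right. -/
inductive PathRel (k : Type w) [Field k] (V : Type u) [Quiver.{v} V] [Fintype V] :
    FreeAlgebra k (PathGen V) → FreeAlgebra k (PathGen V) → Prop
  | idem (a : V) :
      PathRel k V (FreeAlgebra.ι k (.vertex a) * FreeAlgebra.ι k (.vertex a))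
        (FreeAlgebra.ι k (.vertex a))
  | ortho (a b : V) (h : a ≠ b) :
      PathRel k V (FreeAlgebra.ι k (.vertex a) * FreeAlgebra.ι k (.vertex b)) 0
  | sum_eq_one : PathRel k V (∑ a : V, FreeAlgebra.ι k (.vertex a)) 1
  | source {a b : V} (f : a ⟶ b) :
      PathRel k V (FreeAlgebra.ι k (.vertex a) * FreeAlgebra.ι k (.arrow f))
        (FreeAlgebra.ι k (.arrow f))
  | target {a b : V} (f : a ⟶ b) :
      PathRel k V (FreeAlgebra.ι k (.arrow f) * FreeAlgebra.ι k (.vertex b))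
        (FreeAlgebra.ι k (.arrow f))

/-- The path algebra over `k` of a quiver with finitely many vertices. -/
abbrev PathAlg (k : Type w) [Field k] (V : Type u) [Quiver.{v} V] [Fintype V] :
    Type (max u v w) :=
  RingQuot (PathRel k V)

/-- An arrow, as an element of the path algebra. -/
noncomputable def PathAlg.arrow (k : Type w) [Field k] {V : Type u} [Quiver.{v} V] [Fintype V]
    {a b : V} (f : a ⟶ b) : PathAlg k V :=
  RingQuot.mkAlgHom k (PathRel k V) (FreeAlgebra.ι k (.arrow f))

/-! ### Zig-zag algebras -/

/-- The vertices of the double quiver of a graph `G`. -/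
def DoubleQuiver {V : Type u} (_G : SimpleGraph V) : Type u := V

/-- The double quiver of `G`: every edge `a — b` is replaced by two arrows `a ⟶ b`, `b ⟶ a`. -/
instance DoubleQuiver.instQuiver {V : Type u} (G : SimpleGraph V) :
    Quiver.{0} (DoubleQuiver G) where
  Hom a b := PLift (G.Adj a b)

instance DoubleQuiver.instFintype {V : Type u} [Fintype V] (G : SimpleGraph V) :
    Fintype (DoubleQuiver G) :=
  inferInstanceAs (Fintype V)

/-- The zig-zag relations: paths of length three vanish, paths of length two which are not
cycles vanish, and all cycles of length two at a given vertex are equal. -/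
inductive ZigzagRel (k : Type w) [Field k] {V : Type u} [Fintype V] (G : SimpleGraph V) :
    PathAlg k (DoubleQuiver G) → PathAlg k (DoubleQuiver G) → Prop
  | length_three {a b c d : DoubleQuiver G} (f : a ⟶ b) (g : b ⟶ c) (h : c ⟶ d) :
      ZigzagRel k G (PathAlg.arrow k f * PathAlg.arrow k g * PathAlg.arrow k h) 0
  | not_cycle {a b c : DoubleQuiver G} (f : a ⟶ b) (g : b ⟶ c) (hac : a ≠ c) :
      ZigzagRel k G (PathAlg.arrow k f * PathAlg.arrow k g) 0
  | cycles {a b c : DoubleQuiver G} (f : a ⟶ b) (f' : b ⟶ a) (g : a ⟶ c) (g' : c ⟶ a) :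
      ZigzagRel k G (PathAlg.arrow k f * PathAlg.arrow k f')
        (PathAlg.arrow k g * PathAlg.arrow k g')

/-- The zig-zag algebra of a finite graph. -/
abbrev ZigzagAlg (k : Type w) [Field k] {V : Type u} [Fintype V] (G : SimpleGraph V) :
    Type (max u w) :=
  RingQuot (ZigzagRel k G)

/-- An arrow, as an element of the zig-zag algebra. -/
noncomputable def ZigzagAlg.arrow (k : Type w) [Field k] {V : Type u} [Fintype V]
    {G : SimpleGraph V} {a b : DoubleQuiver G} (f : a ⟶ b) : ZigzagAlg k G :=
  RingQuot.mkAlgHom k (ZigzagRel k G) (PathAlg.arrow k f)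

/-- The type `A` zig-zag algebra `A_n`, for the path `0 — 1 — ⋯ — (n - 1)` (used for `n > 1`). -/
abbrev AlgA (k : Type w) [Field k] (n : ℕ) : Type w :=
  ZigzagAlg k (SimpleGraph.pathGraph n)

/-- The additional relation of `B_n`: the loop of length two at the last vertex vanishes. -/
inductive LeafRel (k : Type w) [Field k] (n : ℕ) : AlgA k n → AlgA k n → Prop
  | loop {a b : DoubleQuiver (SimpleGraph.pathGraph n)} (ha : Fin.val (n := n) a + 1 = n)
      (f : a ⟶ b) (g : b ⟶ a) :
      LeafRel k n (ZigzagAlg.arrow k f * ZigzagAlg.arrow k g) 0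

/-- The algebra `B_n`, the quotient of `A_n` by the loop of length two at the last vertex
(used for `n > 1`). -/
abbrev AlgB (k : Type w) [Field k] (n : ℕ) : Type w :=
  RingQuot (LeafRel k n)

/-!
Write `[M : L]` for the multiplicity of a simple module `L` in `M`. Since `k` is algebraically
closed, `[M : L i]` is the dimension `homDim` of `Hom(P i, M)`. The proof determines the Cartan
matrix `c i j = [P i : L j]`, and then the multiplication.

*Symmetry.* Let `F` be the duality. As `F (P j)` is injective among finitely generated modules
and receives a nonzero map from `L j`, we have
`[P i : L j] ≤ dim Hom(P i, F (P j)) = [F (P j) : L i] ≤ [P j : L i]`, so that `c` is symmetric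
(`cartan_symm`). Only dimensions are compared, so `F` does not have to be `k`-linear.

*Socles.* The standard filtrations write `c` as the product of two unitriangular matrices, so its
rows are distinct. An injective `P i` is uniform; if its socle is `L s`, then `P i` is the
injective envelope of `L s`, so that `c i j = [P j : L s] = c s j` for all `j`, and therefore
`s = i` (`hasSimpleSocle_of_injective`). If in addition `c i i = 1`, then `P i` is simple, and by
symmetry the idempotent of `P i` is central, which contradicts connectedness unless `n = 1`. If
`n = 1`, then `P i` is injective (`injective_of_unique`), contrary to assumption. As the last
projective module is standard, it has `c i i = 1`, hence it is the one that is not injective.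

*Standard modules.* By descending induction on `j`, the standard module `Δ j` has the composition
factors `L j` and `L (j - 1)` (`cartan_eq`). The induction hypothesis implies that for `i < j` no
`Δ l` with `l > j` occurs in `P i`. Therefore the copies of `Δ j` in the standard filtration of
`P i` are submodules (`standard_embeds`). The socle of `P (j - 1)` is simple, so `Δ j` occurs in it
at most once, and it does occur since otherwise `P (j - 1)` would be standard. Thus the socle of
`Δ j` is `L (j - 1)`, and `Δ j` does not embed in `P i` for `i < j - 1`. Symmetry translates this
into the multiplicities of `Δ j`.

*Multiplication.* As the algebra is basic, there are primitive idempotents `e i` with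
`e i Λ ≅ P i` (`IsBasicAlg.exists_idempotents`). The dimensions of `e i Λ e j` are now known. The
simple socles show that a path `i → j → i` does not vanish if `i` is not the last vertex, and
primitivity of `e i` shows that paths of length three vanish. After rescaling the arrows, the
relations of `B_n` hold (`nonempty_algEquiv_algB`).
-/

/-! ### Dimensions of spaces of homomorphisms -/

section HomDim

variable (k : Type*) [Field k] {R : Type*} [Ring R] [Algebra k R]
variable {M N A B C : Type*} [AddCommGroup M] [Module R M] [AddCommGroup N] [Module R N]
  [AddCommGroup A] [Module R A] [AddCommGroup B] [Module R B] [AddCommGroup C] [Module R C]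

/-- The `k`-vector space structure on `Hom_R(M, N)`, for an algebra `R` over `k`. The scalars act
through `algebraMap k R`, so that no `k`-module structure on `M` or `N` has to be chosen. -/
abbrev homModule (k : Type*) [Field k] (R : Type*) [Ring R] [Algebra k R]
    (M N : Type*) [AddCommGroup M] [Module R M] [AddCommGroup N] [Module R N] :
    Module k (M →ₗ[R] N) :=
  letI : Module k N := Module.compHom N (algebraMap k R)
  haveI : IsScalarTower k R N := ⟨fun c r x => by
    change (c • r) • x = algebraMap k R c • (r • x)
    rw [Algebra.smul_def, mul_smul]⟩
  haveI : SMulCommClass R k N := IsScalarTower.to_smulCommClass'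
  inferInstance

attribute [local instance] homModule

/-- The dimension over `k` of `Hom_R(M, N)`. If `M` is the projective cover of a simple module
`L` with endomorphism ring `k`, then this is the multiplicity of `L` in `N`. -/
noncomputable def homDim (k : Type*) [Field k] (R : Type*) [Ring R] [Algebra k R]
    (M N : Type*) [AddCommGroup M] [Module R M] [AddCommGroup N] [Module R N] : ℕ :=
  Module.finrank k (M →ₗ[R] N)

/-- Postcomposition, as a `k`-linear map. -/
def homPost (f : A →ₗ[R] B) : (M →ₗ[R] A) →ₗ[k] (M →ₗ[R] B) where
  toFun g := f.comp g
  map_add' g h := LinearMap.comp_add g h f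
  map_smul' c g := by
    ext x
    exact f.map_smul (algebraMap k R c) (g x)

/-- Precomposition, as a `k`-linear map. -/
def homPre (f : A →ₗ[R] B) : (B →ₗ[R] M) →ₗ[k] (A →ₗ[R] M) where
  toFun g := g.comp f
  map_add' _ _ := rfl
  map_smul' _ _ := rfl

theorem homDim_congr (e : M ≃ₗ[R] A) (e' : N ≃ₗ[R] B) : homDim k R M N = homDim k R A B := by
  refine LinearEquiv.finrank_eq (LinearEquiv.ofBijective
    ((homPost k (e' : N →ₗ[R] B)).comp (homPre k (e.symm : A →ₗ[R] M))) ⟨?_, ?_⟩)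
  · intro f g h
    ext x
    have := LinearMap.congr_fun h (e x)
    simpa [homPre, homPost] using this
  · intro f
    refine ⟨(e'.symm : B →ₗ[R] N).comp (f.comp (e : M →ₗ[R] A)), ?_⟩
    ext x
    simp [homPre, homPost]

theorem homDim_congr_left (e : M ≃ₗ[R] A) : homDim k R M N = homDim k R A N :=
  homDim_congr k e (LinearEquiv.refl R N)

theorem homDim_congr_right (e : N ≃ₗ[R] B) : homDim k R M N = homDim k R M B :=
  homDim_congr k (LinearEquiv.refl R M) e

theorem homDim_eq_zero_of_forall (h : ∀ f : M →ₗ[R] N, f = 0) : homDim k R M N = 0 := by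
  have : Subsingleton (M →ₗ[R] N) := ⟨fun f g => by rw [h f, h g]⟩
  exact Module.finrank_zero_of_subsingleton

variable [Module.Finite k R]

theorem finite_hom [Module.Finite R M] [Module.Finite R N] : Module.Finite k (M →ₗ[R] N) := by
  let : Module k N := Module.compHom N (algebraMap k R)
  let : Module k M := Module.compHom M (algebraMap k R)
  have : IsScalarTower k R N := ⟨fun c r x => by
    change (c • r) • x = algebraMap k R c • (r • x)
    rw [Algebra.smul_def, mul_smul]⟩
  have : IsScalarTower k R M := ⟨fun c r x => by
    change (c • r) • x = algebraMap k R c • (r • x)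
    rw [Algebra.smul_def, mul_smul]⟩
  have : Module.Finite k M := Module.Finite.trans R M
  have : Module.Finite k N := Module.Finite.trans R N
  let φ : (M →ₗ[R] N) →ₗ[k] (M →ₗ[k] N) :=
    { toFun := fun f => f.restrictScalars k
      map_add' := fun f g => rfl
      map_smul' := fun c f => rfl }
  exact Module.Finite.of_injective φ fun f g h => by
    ext x
    exact LinearMap.congr_fun h x

attribute [local instance] finite_hom

theorem homDim_eq_zero_iff [Module.Finite R M] [Module.Finite R N] :
    homDim k R M N = 0 ↔ ∀ f : M →ₗ[R] N, f = 0 := by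
  refine ⟨fun h f => ?_, homDim_eq_zero_of_forall k⟩
  have := Module.finrank_zero_iff.1 h
  exact Subsingleton.elim _ _

theorem homDim_le_of_injective [Module.Finite R M] [Module.Finite R A] [Module.Finite R B]
    {f : A →ₗ[R] B} (hf : Function.Injective f) : homDim k R M A ≤ homDim k R M B := by
  refine LinearMap.finrank_le_finrank_of_injective (f := homPost k (M := M) f) fun g h e => ?_
  ext x
  exact hf (LinearMap.congr_fun e x)

/-- If `A → B → C` is exact at `B`, and `M` is projective, then `Hom(M, -)` is exact at `B`. -/
theorem homDim_le_add [Module.Finite R M] [Module.Finite R A] [Module.Finite R B]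
    [Module.Finite R C] [Module.Projective R M] {f : A →ₗ[R] B} {g : B →ₗ[R] C}
    (hfg : LinearMap.ker g ≤ LinearMap.range f) :
    homDim k R M B ≤ homDim k R M A + homDim k R M C := by
  have h1 := LinearMap.finrank_range_add_finrank_ker (homPost k (M := M) g)
  have h2 : LinearMap.ker (homPost k (M := M) g) ≤ LinearMap.range (homPost k (M := M) f) := by
    intro φ hφ
    have hφ' : ∀ x, φ x ∈ LinearMap.range f := fun x => hfg (LinearMap.congr_fun hφ x)
    obtain ⟨ψ, hψ⟩ := Module.projective_lifting_property f.rangeRestrict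
      (φ.codRestrict _ hφ') f.surjective_rangeRestrict
    refine ⟨ψ, ?_⟩
    ext x
    exact congrArg Subtype.val (LinearMap.congr_fun hψ x)
  have h3 := Submodule.finrank_mono h2
  have h4 := LinearMap.finrank_range_le (homPost k (M := M) f)
  have h5 := Submodule.finrank_le (LinearMap.range (homPost k (M := M) g))
  unfold homDim
  omega

/-- `Hom(M, -)` is additive on short exact sequences for projective `M`. -/
theorem homDim_add_of_projective [Module.Finite R M] [Module.Finite R A] [Module.Finite R B]
    [Module.Finite R C] [Module.Projective R M] {f : A →ₗ[R] B} {g : B →ₗ[R] C}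
    (hf : Function.Injective f) (hfg : LinearMap.ker g = LinearMap.range f)
    (hg : Function.Surjective g) :
    homDim k R M B = homDim k R M A + homDim k R M C := by
  refine le_antisymm (homDim_le_add k hfg.le) ?_
  have h1 := LinearMap.finrank_range_add_finrank_ker (homPost k (M := M) g)
  have h2 : LinearMap.range (homPost k (M := M) f) ≤ LinearMap.ker (homPost k (M := M) g) := by
    rintro _ ⟨ψ, rfl⟩
    ext x
    have : f (ψ x) ∈ LinearMap.ker g := hfg ▸ ⟨ψ x, rfl⟩
    exact this
  have h3 := Submodule.finrank_mono h2
  have h4 : Module.finrank k (LinearMap.range (homPost k (M := M) f)) = homDim k R M A :=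
    LinearMap.finrank_range_of_inj fun φ ψ e => by
      ext x
      exact hf (LinearMap.congr_fun e x)
  have h5 : LinearMap.range (homPost k (M := M) g) = ⊤ := by
    rw [LinearMap.range_eq_top]
    intro φ
    obtain ⟨ψ, hψ⟩ := Module.projective_lifting_property g φ hg
    exact ⟨ψ, hψ⟩
  rw [h5, finrank_top] at h1
  unfold homDim at *
  omega

theorem homDim_quotient_add [Module.Finite R M] [Module.Finite R B] [Module.Projective R M]
    (N : Submodule R B) [Module.Finite R N] :
    homDim k R M B = homDim k R M N + homDim k R M (B ⧸ N) :=
  homDim_add_of_projective k (f := N.subtype) (g := N.mkQ) N.injective_subtype (by simp)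
    N.mkQ_surjective

/-- `Hom(-, M)` is additive on a short exact sequence along which homomorphisms to `M`
extend. -/
theorem homDim_quotient_add' [Module.Finite R M] [Module.Finite R B]
    (N : Submodule R B) [Module.Finite R N]
    (hM : ∀ f : N →ₗ[R] M, ∃ g : B →ₗ[R] M, g.comp N.subtype = f) :
    homDim k R B M = homDim k R N M + homDim k R (B ⧸ N) M := by
  have h1 := LinearMap.finrank_range_add_finrank_ker (homPre k (M := M) N.subtype)
  have h2 : LinearMap.range (homPre k (M := M) N.mkQ) =
      LinearMap.ker (homPre k (M := M) N.subtype) := by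
    apply le_antisymm
    · rintro _ ⟨ψ, rfl⟩
      ext x
      change ψ (N.mkQ x) = 0
      rw [Submodule.mkQ_apply, (Submodule.Quotient.mk_eq_zero N).2 x.2, map_zero]
    · intro φ hφ
      refine ⟨N.liftQ φ fun x hx => LinearMap.congr_fun hφ ⟨x, hx⟩, ?_⟩
      rfl
  have h4 : Module.finrank k (LinearMap.range (homPre k (M := M) N.mkQ)) =
      homDim k R (B ⧸ N) M :=
    LinearMap.finrank_range_of_inj fun φ ψ e => by
      ext x
      exact LinearMap.congr_fun e x
  have h5 : LinearMap.range (homPre k (M := M) N.subtype) = ⊤ := by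
    rw [LinearMap.range_eq_top]
    exact hM
  rw [h5, finrank_top, ← h2, h4] at h1
  exact h1.symm

/-- Schur's lemma. -/
theorem homDim_self_of_isSimpleModule [IsAlgClosed k] [IsSimpleModule R M] [Module.Finite R M] :
    homDim k R M M = 1 := by
  have := IsSimpleModule.nontrivial R M
  have hid : (LinearMap.id : M →ₗ[R] M) ≠ 0 := fun h => by
    obtain ⟨x, hx⟩ := exists_ne (0 : M)
    exact hx (LinearMap.congr_fun h x)
  refine (finrank_eq_one_iff_of_nonzero' _ hid).2 fun f => ?_
  have : Nontrivial (M →ₗ[R] M) := ⟨⟨_, _, hid⟩⟩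
  obtain ⟨c, hc⟩ := Module.End.exists_eigenvalue (homPost k (M := M) f)
  obtain ⟨g, hg⟩ := hc.exists_hasEigenvector
  refine ⟨c, ?_⟩
  have h0 : (f - c • LinearMap.id).comp g = 0 := by
    ext x
    have := LinearMap.congr_fun hg.apply_eq_smul x
    simp only [homPost, LinearMap.coe_mk, AddHom.coe_mk, LinearMap.comp_apply] at this
    simp [this]
  rcases LinearMap.bijective_or_eq_zero (f - c • (LinearMap.id : M →ₗ[R] M)) with h | h
  · refine absurd ?_ hg.2
    ext x
    exact h.1 (by simpa using LinearMap.congr_fun h0 x)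
  · exact (sub_eq_zero.1 h).symm

end HomDim

/-! ### Projective covers of simple modules -/

section FiniteLength

variable {R : Type u} [Ring R]

/-- Finitely generated modules over an Artinian ring are built from simple quotients. -/
theorem finite_module_induction [IsArtinianRing R]
    {motive : ∀ (M : Type u) [AddCommGroup M] [Module R M], Prop}
    (zero : ∀ (M : Type u) [AddCommGroup M] [Module R M] [Subsingleton M], motive M)
    (ext : ∀ (M : Type u) [AddCommGroup M] [Module R M] [Module.Finite R M] (N : Submodule R M),
      IsSimpleModule R (M ⧸ N) → motive N → motive M)
    (M : Type u) [AddCommGroup M] [Module R M] [hM : Module.Finite R M] : motive M := by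
  have h : IsFiniteLength R M :=
    isFiniteLength_iff_isNoetherian_isArtinian.2 ⟨inferInstance, inferInstance⟩
  revert hM
  induction h with
  | of_subsingleton => exact zero _
  | @of_simple_quotient M _ _ N hN _ ih => exact ext M N hN ih

variable {n : ℕ} {L : Fin n → ModuleCat.{u} R}

theorem IsFullSetOfSimples.exists_surjective (hL : IsFullSetOfSimples L) (M : Type u)
    [AddCommGroup M] [Module R M] [Module.Finite R M] [Nontrivial M] :
    ∃ i, ∃ q : M →ₗ[R] L i, Function.Surjective q := by
  obtain ⟨N, hN, -⟩ := (eq_top_or_exists_le_coatom (⊥ : Submodule R M)).resolve_left bot_ne_top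
  have : IsSimpleModule R (M ⧸ N) := isSimpleModule_iff_isCoatom.2 hN
  obtain ⟨i, ⟨e⟩⟩ := hL.exists_iso (ModuleCat.of R (M ⧸ N)) this
  exact ⟨i, (e : (M ⧸ N) →ₗ[R] L i).comp N.mkQ, e.surjective.comp N.mkQ_surjective⟩

theorem IsFullSetOfSimples.exists_injective (hL : IsFullSetOfSimples L) (M : Type u)
    [AddCommGroup M] [Module R M] [IsArtinian R M] [Nontrivial M] :
    ∃ i, ∃ q : L i →ₗ[R] M, Function.Injective q := by
  obtain ⟨N, hN, -⟩ := (eq_bot_or_exists_atom_le (⊤ : Submodule R M)).resolve_left top_ne_bot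
  have : IsSimpleModule R N := isSimpleModule_iff_isAtom.2 hN
  obtain ⟨i, ⟨e⟩⟩ := hL.exists_iso (ModuleCat.of R N) this
  exact ⟨i, N.subtype.comp (e.symm : L i →ₗ[R] N), N.injective_subtype.comp e.symm.injective⟩

end FiniteLength

section ProjectiveCover

variable {R : Type u} [Ring R] {P L : ModuleCat.{v} R}

theorem IsProjectiveCover.finite (h : IsProjectiveCover P L) [IsSimpleModule R L] :
    Module.Finite R P := by
  obtain ⟨-, p, hp, hmax⟩ := h
  have := IsSimpleModule.nontrivial R L
  obtain ⟨y, hy⟩ := exists_ne (0 : L)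
  obtain ⟨x, rfl⟩ := hp y
  refine ⟨⟨{x}, ?_⟩⟩
  rw [Finset.coe_singleton]
  apply hmax
  have h1 : (Submodule.span R {x}).map p = ⊤ := by
    rw [Submodule.map_span, Set.image_singleton]
    exact IsSimpleModule.span_singleton_eq_top R hy
  rw [← Submodule.comap_map_eq, h1, Submodule.comap_top]

theorem IsProjectiveCover.nontrivial (h : IsProjectiveCover P L) [IsSimpleModule R L] :
    Nontrivial P := by
  obtain ⟨-, p, hp, -⟩ := h
  have := IsSimpleModule.nontrivial R L
  exact hp.nontrivial

/-- Every homomorphism from the projective cover of a simple module to a simple module factors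
through the covering map. -/
theorem IsProjectiveCover.exists_factor (h : IsProjectiveCover P L) [IsSimpleModule R L] :
    ∃ p : P →ₗ[R] L, Function.Surjective p ∧
      (∀ N : Submodule R P, N ⊔ LinearMap.ker p = ⊤ → N = ⊤) ∧
      ∀ {S : Type w} [AddCommGroup S] [Module R S] [IsSimpleModule R S] (f : P →ₗ[R] S),
        ∃ g : L →ₗ[R] S, g.comp p = f := by
  obtain ⟨-, p, hp, hmax⟩ := h
  refine ⟨p, hp, hmax, fun {S} _ _ _ f => ?_⟩
  have hker : LinearMap.ker p ≤ LinearMap.ker f := by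
    rw [LinearMap.le_ker_iff_map]
    refine (eq_bot_or_eq_top _).resolve_right fun h => ?_
    have h1 : LinearMap.ker f ⊔ LinearMap.ker p = ⊤ := by
      rw [sup_comm, ← Submodule.comap_map_eq, h, Submodule.comap_top]
    have h2 : f = 0 := LinearMap.ker_eq_top.1 (hmax _ h1)
    rw [h2, Submodule.map_zero] at h
    exact bot_ne_top h
  refine ⟨((LinearMap.ker p).liftQ f hker).comp
    ((p.quotKerEquivOfSurjective hp).symm : L →ₗ[R] _), ?_⟩
  ext x
  have : (p.quotKerEquivOfSurjective hp).symm (p x) = (LinearMap.ker p).mkQ x := by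
    rw [LinearEquiv.symm_apply_eq]
    rfl
  simp [this]

/-- A projective cover of a simple module is local: the sum of two non-surjective maps to it is
not surjective. -/
theorem IsProjectiveCover.surjective_or (h : IsProjectiveCover P L) [IsSimpleModule R L]
    {M : Type w} [AddCommGroup M] [Module R M] (f g : M →ₗ[R] P)
    (hfg : Function.Surjective (f + g)) : Function.Surjective f ∨ Function.Surjective g := by
  obtain ⟨-, p, hp, hmax⟩ := h
  have key : ∀ f : M →ₗ[R] P, ¬ Function.Surjective f → p.comp f = 0 := by
    intro f hf
    have h1 : LinearMap.range (p.comp f) = ⊥ := by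
      refine (eq_bot_or_eq_top _).resolve_right fun h => hf ?_
      rw [← LinearMap.range_eq_top]
      apply hmax
      rw [← Submodule.comap_map_eq, ← LinearMap.range_comp, h, Submodule.comap_top]
    exact LinearMap.range_eq_bot.1 h1
  by_contra! hcon
  have h0 : p.comp (f + g) = 0 := by
    rw [LinearMap.comp_add, key f hcon.1, key g hcon.2, add_zero]
  have := IsSimpleModule.nontrivial R L
  obtain ⟨y, hy⟩ := exists_ne (0 : L)
  obtain ⟨x, rfl⟩ := (hp.comp hfg) y
  exact hy (LinearMap.congr_fun h0 x)

/-- Injective projective covers of simple modules are uniform. -/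
theorem IsProjectiveCover.eq_bot_or_eq_bot (h : IsProjectiveCover P L) [IsSimpleModule R L]
    [IsNoetherianRing R] (hI : Module.Injective R P) {N₁ N₂ : Submodule R P}
    (hN : Disjoint N₁ N₂) : N₁ = ⊥ ∨ N₂ = ⊥ := by
  have := h.finite
  have hinj : Function.Injective (N₁.subtype.coprod N₂.subtype) := by
    rw [← LinearMap.ker_eq_bot, LinearMap.ker_coprod_of_disjoint_range]
    · simp
    · simpa using hN
  obtain ⟨f, hf⟩ := hI.out (N₁.subtype.coprod N₂.subtype) hinj
    (N₁.subtype.comp (LinearMap.fst R N₁ N₂))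
  have hf1 : ∀ x ∈ N₁, f x = x := fun x hx => by simpa using hf (⟨x, hx⟩, 0)
  have hf2 : ∀ x ∈ N₂, f x = 0 := fun x hx => by simpa using hf (0, ⟨x, hx⟩)
  rcases h.surjective_or f (LinearMap.id - f) (by
    rw [add_sub_cancel]
    exact Function.surjective_id) with hs | hs
  · right
    refine (Submodule.eq_bot_iff _).2 fun x hx => ?_
    exact IsNoetherian.injective_of_surjective_endomorphism f hs (by rw [hf2 x hx, map_zero])
  · left
    refine (Submodule.eq_bot_iff _).2 fun x hx => ?_
    refine IsNoetherian.injective_of_surjective_endomorphism _ hs ?_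
    simp [hf1 x hx]

end ProjectiveCover

/-! ### Multiplicities of simple modules -/

section Multiplicity

variable (k : Type*) [Field k] {R : Type u} [Ring R] [Algebra k R]

attribute [local instance] homModule finite_hom

theorem IsProjectiveCover.homDim_eq {P L : ModuleCat.{v} R} (h : IsProjectiveCover P L)
    [IsSimpleModule R L] (S : Type w) [AddCommGroup S] [Module R S] [IsSimpleModule R S] :
    homDim k R P S = homDim k R L S := by
  obtain ⟨p, hp, -, hfac⟩ := h.exists_factor
  refine (LinearEquiv.finrank_eq (LinearEquiv.ofBijective (homPre k (M := S) p) ⟨?_, ?_⟩)).symm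
  · intro f g hfg
    ext x
    obtain ⟨y, rfl⟩ := hp x
    exact LinearMap.congr_fun hfg y
  · exact fun f => hfac f

theorem IsFullSetOfSimples.homDim_eq [IsAlgClosed k] [Module.Finite k R] {n : ℕ}
    {L : Fin n → ModuleCat.{v} R}
    (hL : IsFullSetOfSimples L) (i j : Fin n) :
    homDim k R (L i) (L j) = if i = j then 1 else 0 := by
  have := hL.simple i
  have := hL.simple j
  split_ifs with hij
  · subst hij
    have : Module.Finite R (L i) := by
      have := IsSimpleModule.nontrivial R (L i)
      obtain ⟨y, hy⟩ := exists_ne (0 : L i)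
      exact ⟨⟨{y}, by
        rw [Finset.coe_singleton]
        exact IsSimpleModule.span_singleton_eq_top R hy⟩⟩
    exact homDim_self_of_isSimpleModule k
  · refine homDim_eq_zero_of_forall k fun f => ?_
    refine (LinearMap.bijective_or_eq_zero f).resolve_left fun hf => ?_
    exact (hL.not_iso i j hij).false (LinearEquiv.ofBijective f hf)

theorem homDim_projectiveCover [IsAlgClosed k] [Module.Finite k R] {n : ℕ}
    {L P : Fin n → ModuleCat.{v} R} (hL : IsFullSetOfSimples L)
    (hP : ∀ i, IsProjectiveCover (P i) (L i)) (i j : Fin n) :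
    homDim k R (P i) (L j) = if i = j then 1 else 0 := by
  have := hL.simple i
  have := hL.simple j
  rw [(hP i).homDim_eq k, hL.homDim_eq k]

end Multiplicity

/-! ### Simple socles -/

section Socle

variable (k : Type*) [Field k] {R : Type u} [Ring R] [Algebra k R]

attribute [local instance] homModule finite_hom

/-- The simple module `S` embeds in `M`, and its image is contained in every nonzero submodule of
`M`. In other words, the socle of `M` is essential and isomorphic to `S`. -/
def HasSimpleSocle (R : Type*) [Ring R] (S M : Type*) [AddCommGroup S] [Module R S]
    [AddCommGroup M] [Module R M] : Prop :=
  ∃ σ : S →ₗ[R] M, Function.Injective σ ∧ ∀ N : Submodule R M, N ≠ ⊥ → LinearMap.range σ ≤ N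

variable {S T M : Type*} [AddCommGroup S] [Module R S] [AddCommGroup M] [Module R M]
  [AddCommGroup T] [Module R T]

/-- A homomorphism from a simple module to a module with simple socle factors through the socle. -/
theorem HasSimpleSocle.exists_comp [IsSimpleModule R T] {σ : S →ₗ[R] M}
    (hN : ∀ N : Submodule R M, N ≠ ⊥ → LinearMap.range σ ≤ N) [Nontrivial S]
    (hσ : Function.Injective σ)
    (f : T →ₗ[R] M) : ∃ g : T →ₗ[R] S, σ.comp g = f := by
  by_cases hf : f = 0
  · exact ⟨0, by rw [hf, LinearMap.comp_zero]⟩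
  · have hinj : Function.Injective f := LinearMap.injective_of_ne_zero hf
    have hle := hN (LinearMap.range f) fun h => hf (LinearMap.range_eq_bot.1 h)
    have hle' : LinearMap.range f ≤ LinearMap.range σ := by
      have h1 : (LinearMap.range σ).comap f = ⊤ := by
        refine (eq_bot_or_eq_top _).resolve_left fun h => ?_
        obtain ⟨y, hy⟩ := exists_ne (0 : S)
        obtain ⟨x, hx⟩ := hle ⟨y, rfl⟩
        have : x ∈ (LinearMap.range σ).comap f := ⟨y, hx.symm⟩
        rw [h, Submodule.mem_bot] at this
        rw [this, map_zero] at hx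
        exact hy (hσ (by rw [← hx, map_zero]))
      rw [LinearMap.range_eq_map, Submodule.map_le_iff_le_comap, h1]
    refine ⟨((LinearEquiv.ofInjective σ hσ).symm : LinearMap.range σ →ₗ[R] S).comp
      (f.codRestrict (LinearMap.range σ) fun x => hle' ⟨x, rfl⟩), ?_⟩
    ext x
    have := (LinearEquiv.ofInjective σ hσ).apply_symm_apply ⟨f x, hle' ⟨x, rfl⟩⟩
    exact congrArg Subtype.val this

theorem HasSimpleSocle.homDim_eq [IsSimpleModule R T] [Nontrivial S] (h : HasSimpleSocle R S M) :
    homDim k R T M = homDim k R T S := by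
  obtain ⟨σ, hσ, hN⟩ := h
  refine (LinearEquiv.finrank_eq (LinearEquiv.ofBijective (homPost k (M := T) σ) ⟨?_, ?_⟩)).symm
  · intro f g hfg
    ext x
    exact hσ (LinearMap.congr_fun hfg x)
  · exact fun f => HasSimpleSocle.exists_comp hN hσ f

theorem IsProjectiveCover.exists_hasSimpleSocle [IsArtinianRing R] {n : ℕ}
    {L : Fin n → ModuleCat.{u} R} (hL : IsFullSetOfSimples L) {P : ModuleCat.{u} R} {i : Fin n}
    (hP : IsProjectiveCover P (L i)) (hI : Module.Injective R P) :
    ∃ s, HasSimpleSocle R (L s) P := by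
  have := hL.simple i
  have := hP.finite
  have := hP.nontrivial
  obtain ⟨s, σ, hσ⟩ := hL.exists_injective P
  refine ⟨s, σ, hσ, fun N hN => ?_⟩
  have := hL.simple s
  have := IsSimpleModule.nontrivial R (L s)
  have hne : LinearMap.range σ ≠ ⊥ := fun h => by
    obtain ⟨y, hy⟩ := exists_ne (0 : L s)
    rw [LinearMap.range_eq_bot] at h
    exact hy (hσ (by rw [h]; rfl))
  have hatom : IsAtom (LinearMap.range σ) := isSimpleModule_iff_isAtom.1
    (IsSimpleModule.congr (LinearEquiv.ofInjective σ hσ).symm)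
  by_contra hle
  rcases hP.eq_bot_or_eq_bot hI (hatom.not_le_iff_disjoint.1 hle) with h | h
  · exact hne h
  · exact hN h

/-- If `P` is an injective module with simple socle `L s`, then it is the injective envelope of
`L s`, so that homomorphisms to it count the composition factors `L s`. -/
theorem homDim_to_injective [IsAlgClosed k] [Module.Finite k R] [IsArtinianRing R] {n : ℕ}
    {L P : Fin n → ModuleCat.{u} R} (hL : IsFullSetOfSimples L)
    (hP : ∀ i, IsProjectiveCover (P i) (L i)) {s : Fin n} {Q : Type u} [AddCommGroup Q]
    [Module R Q] [Module.Finite R Q] (hQ : Module.Injective R Q) (hs : HasSimpleSocle R (L s) Q)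
    (M : Type u) [AddCommGroup M] [Module R M] [Module.Finite R M] :
    homDim k R M Q = homDim k R (P s) M := by
  have := hL.simple s
  have := (hP s).finite
  have := (hP s).1
  have := IsSimpleModule.nontrivial R (L s)
  refine finite_module_induction (R := R)
    (motive := fun M _ _ => homDim k R M Q = homDim k R (P s) M) ?_ ?_ M
  · intro M _ _ _
    rw [homDim_eq_zero_of_forall k, homDim_eq_zero_of_forall k]
    · intro f
      ext x
      exact Subsingleton.elim _ _
    · intro f
      ext x
      rw [Subsingleton.elim x 0, map_zero, map_zero]
  · intro M _ _ _ N hN ih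
    have ext : ∀ f : N →ₗ[R] Q, ∃ g : M →ₗ[R] Q, g.comp N.subtype = f := fun f => by
      obtain ⟨g, hg⟩ := hQ.out N.subtype N.injective_subtype f
      exact ⟨g, LinearMap.ext hg⟩
    rw [homDim_quotient_add' k N ext, homDim_quotient_add k N, ih, hs.homDim_eq k (T := M ⧸ N),
      (hP s).homDim_eq k (M ⧸ N)]
    congr 1
    obtain ⟨t, ⟨e⟩⟩ := hL.exists_iso (ModuleCat.of R (M ⧸ N)) hN
    change (M ⧸ N) ≃ₗ[R] L t at e
    rw [homDim_congr_left k e, homDim_congr_right k e, hL.homDim_eq k, hL.homDim_eq k]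
    simp only [eq_comm]

end Socle

/-! ### Simple preserving dualities and the symmetry of the Cartan matrix -/

section Duality

attribute [local instance] homModule finite_hom

variable {R : Type u} [Ring R]

theorem FGModuleCat.mono_of_injective {A B : FGModuleCat.{u} R} (f : A ⟶ B)
    (hf : Function.Injective f.hom.hom) : Mono f :=
  ⟨fun g h e => by
    ext x
    exact hf (congrArg (fun t => t.hom.hom x) e)⟩

theorem FGModuleCat.epi_of_surjective {A B : FGModuleCat.{u} R} (f : A ⟶ B)
    (hf : Function.Surjective f.hom.hom) : Epi f :=
  ⟨fun g h e => by
    ext x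
    obtain ⟨y, rfl⟩ := hf x
    exact congrArg (fun t => t.hom.hom y) e⟩

theorem FGModuleCat.surjective_of_epi {A B : FGModuleCat.{u} R} (f : A ⟶ B) [Epi f] :
    Function.Surjective f.hom.hom := by
  let q : B ⟶ FGModuleCat.of R (B ⧸ LinearMap.range f.hom.hom) :=
    FGModuleCat.ofHom (LinearMap.range f.hom.hom).mkQ
  have h : f ≫ q = f ≫ 0 := by
    ext x
    exact (Submodule.Quotient.mk_eq_zero _).2 ⟨x, rfl⟩
  have hq : q = 0 := (cancel_epi f).1 h
  rw [← LinearMap.range_eq_top, ← Submodule.ker_mkQ (LinearMap.range f.hom.hom),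
    LinearMap.ker_eq_top]
  exact congrArg (fun t => t.hom.hom) hq

theorem FGModuleCat.projective_of (A : FGModuleCat.{u} R) [Module.Projective R A] :
    Projective A :=
  ⟨fun {E X} f e _ => by
    obtain ⟨g, hg⟩ := Module.projective_lifting_property e.hom.hom f.hom.hom
      (FGModuleCat.surjective_of_epi e)
    exact ⟨FGModuleCat.ofHom g, by
      ext x
      exact LinearMap.congr_fun hg x⟩⟩

variable (F : (FGModuleCat.{u} R)ᵒᵖ ⥤ FGModuleCat.{u} R) [F.IsEquivalence]

/-- A contravariant equivalence is exact in the middle. -/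
theorem ker_map_le_range_map [IsNoetherianRing R] {M : Type u} [AddCommGroup M] [Module R M]
    [Module.Finite R M] (N : Submodule R M) :
    LinearMap.ker (F.map (FGModuleCat.ofHom N.subtype).op).hom.hom ≤
      LinearMap.range (F.map (FGModuleCat.ofHom N.mkQ).op).hom.hom := by
  intro x hx
  let ι : FGModuleCat.of R N ⟶ FGModuleCat.of R M := FGModuleCat.ofHom N.subtype
  let K := LinearMap.ker (F.map ι.op).hom.hom
  let κ : FGModuleCat.of R K ⟶ F.obj (Opposite.op (FGModuleCat.of R M)) :=
    FGModuleCat.ofHom K.subtype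
  let i := F.objObjPreimageIso (FGModuleCat.of R K)
  let κ' := (F.preimage (i.hom ≫ κ)).unop
  have h1 : F.map κ'.op = i.hom ≫ κ := F.map_preimage _
  have h2 : ι ≫ κ' = 0 := by
    have : (ι ≫ κ').op = 0 := F.map_injective (by
      rw [op_comp, F.map_comp, h1, F.map_zero, Category.assoc]
      have : κ ≫ F.map ι.op = 0 := by
        ext y
        exact y.2
      rw [this, Limits.comp_zero])
    exact Quiver.Hom.op_inj this
  let t : FGModuleCat.of R (M ⧸ N) ⟶ (F.objPreimage (FGModuleCat.of R K)).unop :=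
    FGModuleCat.ofHom (N.liftQ κ'.hom.hom fun y hy =>
      LinearMap.mem_ker.2 (LinearMap.congr_fun (congrArg (fun t => t.hom.hom) h2) (⟨y, hy⟩ : N)))
  have h3 : κ' = FGModuleCat.ofHom N.mkQ ≫ t := by
    ext y
    rfl
  have h4 : κ = i.inv ≫ F.map t.op ≫ F.map (FGModuleCat.ofHom N.mkQ).op := by
    rw [← F.map_comp, ← op_comp, ← h3, h1, Iso.inv_hom_id_assoc]
  have h5 : κ.hom.hom ⟨x, hx⟩ = x := rfl
  rw [h4] at h5
  exact ⟨_, h5⟩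

variable (k : Type*) [Field k] [Algebra k R] [Module.Finite k R]
  [IsArtinianRing R] {n : ℕ} {L P : Fin n → ModuleCat.{u} R}

/-- A simple preserving duality does not increase multiplicities. -/
theorem homDim_map_le (hL : IsFullSetOfSimples L) (hP : ∀ i, IsProjectiveCover (P i) (L i))
    (hF : ∀ S : FGModuleCat.{u} R, IsSimpleModule R S → Nonempty (F.obj (Opposite.op S) ≅ S))
    (i : Fin n) (M : Type u) [AddCommGroup M] [Module R M] [Module.Finite R M] :
    homDim k R (P i) (F.obj (Opposite.op (FGModuleCat.of R M))) ≤ homDim k R (P i) M := by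
  have := hL.simple i
  have := (hP i).finite
  have := (hP i).1
  suffices h : ∀ h : Module.Finite R M, homDim k R (P i)
      (F.obj (Opposite.op (FGModuleCat.of R M))) ≤ homDim k R (P i) M from h _
  refine finite_module_induction (R := R) (motive := fun M _ _ => ∀ h : Module.Finite R M,
    homDim k R (P i) (F.obj (Opposite.op (FGModuleCat.of R M))) ≤ homDim k R (P i) M) ?_ ?_ M
  · intro M _ _ _ _
    rw [homDim_eq_zero_of_forall k]
    · exact Nat.zero_le _
    · intro f
      have h : 𝟙 (FGModuleCat.of R M) = 0 := by
        ext x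
        exact Subsingleton.elim _ _
      have h' : 𝟙 (F.obj (Opposite.op (FGModuleCat.of R M))) = 0 := by
        rw [← F.map_id, ← op_id, h, Limits.op_zero, F.map_zero]
      ext x
      exact congrArg (fun t => t.hom.hom (f x)) h'
  · intro M _ _ _ N hN ih _
    refine (homDim_le_add k (ker_map_le_range_map F N)).trans ?_
    rw [homDim_quotient_add k N, add_comm]
    refine add_le_add (ih _) (le_of_eq ?_)
    obtain ⟨e⟩ := hF (FGModuleCat.of R (M ⧸ N)) hN
    exact homDim_congr_right k (FGModuleCat.isoToLinearEquiv e)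

variable [IsAlgClosed k]

/-- The dual of a projective cover of `L j` is injective, and receives enough homomorphisms to
detect all composition factors `L j`. -/
theorem homDim_le_homDim_map (hL : IsFullSetOfSimples L)
    (hP : ∀ i, IsProjectiveCover (P i) (L i))
    (hF : ∀ S : FGModuleCat.{u} R, IsSimpleModule R S → Nonempty (F.obj (Opposite.op S) ≅ S))
    (j : Fin n) [Module.Finite R (P j)] (M : Type u) [AddCommGroup M] [Module R M]
    [Module.Finite R M] :
    homDim k R (P j) M ≤ homDim k R M (F.obj (Opposite.op (FGModuleCat.of R (P j)))) := by
  have := hL.simple j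
  have := (hP j).1
  let Q := F.obj (Opposite.op (FGModuleCat.of R (P j)))
  have hproj : Projective (FGModuleCat.of R (P j)) := FGModuleCat.projective_of _
  have hinj : Injective Q := (F.asEquivalence.map_injective_iff _).2 inferInstance
  refine finite_module_induction (R := R)
    (motive := fun M _ _ => homDim k R (P j) M ≤ homDim k R M Q) ?_ ?_ M
  · intro M _ _ _
    rw [homDim_eq_zero_of_forall k]
    · exact Nat.zero_le _
    · intro f
      ext x
      exact Subsingleton.elim _ _
  · intro M _ _ _ N hN ih
    have ext : ∀ f : N →ₗ[R] Q, ∃ g : M →ₗ[R] Q, g.comp N.subtype = f := fun f => by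
      let ι : FGModuleCat.of R N ⟶ FGModuleCat.of R M := FGModuleCat.ofHom N.subtype
      have : Mono ι := FGModuleCat.mono_of_injective ι N.injective_subtype
      let f' : FGModuleCat.of R N ⟶ Q := FGModuleCat.ofHom f
      refine ⟨(Injective.factorThru f' ι).hom.hom, ?_⟩
      exact congrArg (fun t => t.hom.hom) (Injective.comp_factorThru f' ι)
    rw [homDim_quotient_add' k N ext, homDim_quotient_add k N]
    refine add_le_add ih ?_
    obtain ⟨t, ⟨e⟩⟩ := hL.exists_iso (ModuleCat.of R (M ⧸ N)) hN
    change (M ⧸ N) ≃ₗ[R] L t at e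
    rw [homDim_congr_left k e, homDim_congr_right k e, homDim_projectiveCover k hL hP]
    split_ifs with hjt
    · subst hjt
      have : Module.Finite R (L j) := Module.Finite.equiv e
      obtain ⟨-, p, hp, -⟩ := hP j
      let p' : FGModuleCat.of R (P j) ⟶ FGModuleCat.of R (L j) := FGModuleCat.ofHom p
      have : Epi p' := FGModuleCat.epi_of_surjective p' hp
      obtain ⟨i⟩ := hF (FGModuleCat.of R (L j)) inferInstance
      rw [Nat.one_le_iff_ne_zero, Ne, homDim_eq_zero_iff]
      intro h0
      have h1 : i.inv ≫ F.map p'.op = 0 := by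
        ext x
        exact LinearMap.congr_fun (h0 (i.inv ≫ F.map p'.op).hom.hom) x
      have h2 : i.inv = 0 := by
        rw [← cancel_mono (F.map p'.op), h1, Limits.zero_comp]
      have h3 : 𝟙 (FGModuleCat.of R (L j)) = 0 := by
        rw [← i.inv_hom_id, h2, Limits.zero_comp]
      have := IsSimpleModule.nontrivial R (L j)
      obtain ⟨y, hy⟩ := exists_ne (0 : L j)
      exact hy (congrArg (fun t => t.hom.hom y) h3)
    · exact Nat.zero_le _

/-- The Cartan matrix of an algebra with a simple preserving duality is symmetric. -/
theorem cartan_symm (hL : IsFullSetOfSimples L) (hP : ∀ i, IsProjectiveCover (P i) (L i))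
    (hdual : HasSimplePreservingDuality R) (i j : Fin n) :
    homDim k R (P i) (P j) = homDim k R (P j) (P i) := by
  obtain ⟨F, hF, -, hS⟩ := hdual
  suffices h : ∀ i j, homDim k R (P i) (P j) ≤ homDim k R (P j) (P i) from
    le_antisymm (h i j) (h j i)
  intro i j
  have := hL.simple i
  have := (hP i).finite
  have := hL.simple j
  have := (hP j).finite
  exact (homDim_le_homDim_map F k hL hP hS i (P j)).trans (homDim_map_le F k hL hP hS j (P i))

end Duality

/-! ### Standard filtrations -/

section Filtration

variable {R : Type u} [Ring R]

theorem HasFiltration.induction [IsNoetherianRing R] {S : Set (ModuleCat.{v} R)}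
    {motive : ∀ (M : Type w) [AddCommGroup M] [Module R M], Prop}
    (zero : ∀ (M : Type w) [AddCommGroup M] [Module R M] [Subsingleton M], motive M)
    (congr : ∀ (M M' : Type w) [AddCommGroup M] [Module R M] [AddCommGroup M'] [Module R M'],
      (M ≃ₗ[R] M') → motive M → motive M')
    (ext : ∀ (M : Type w) [AddCommGroup M] [Module R M] [Module.Finite R M] (N : Submodule R M)
      (X : ModuleCat.{v} R), X ∈ S → ((M ⧸ N) ≃ₗ[R] X) → motive N → motive M)
    {M : Type w} [AddCommGroup M] [Module R M] [Module.Finite R M] (h : HasFiltration S M) :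
    motive M := by
  obtain ⟨m, N, h0, hm, hN⟩ := h
  have key : ∀ t, motive (N t) := by
    intro t
    induction t using Fin.induction with
    | zero =>
      rw [h0]
      exact zero _
    | succ t ih =>
      obtain ⟨hle, X, hX, ⟨e⟩⟩ := hN t
      exact ext _ _ X hX e (congr _ _ (Submodule.submoduleOfEquivOfLe hle).symm ih)
  have h1 := key (Fin.last m)
  rw [hm] at h1
  exact congr _ _ Submodule.topEquiv h1

variable (k : Type*) [Field k] [Algebra k R] [Module.Finite k R]
  [IsArtinianRing R] {n : ℕ} {L P Δ : Fin n → ModuleCat.{u} R}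

/-- The composition factors of the standard module `Δ j`. -/
theorem homDim_standard [IsAlgClosed k] (hL : IsFullSetOfSimples L)
    (hP : ∀ i, IsProjectiveCover (P i) (L i))
    {j : Fin n} [Module.Finite R (Δ j)] {q : Δ j →ₗ[R] L j} (hq : Function.Surjective q)
    (hker : HasFiltration {X | ∃ t, t < j ∧ X = L t} (LinearMap.ker q)) {l : Fin n}
    (hl : j ≤ l) : homDim k R (P l) (Δ j) = if l = j then 1 else 0 := by
  have := hL.simple l
  have := (hP l).finite
  have := (hP l).1
  rw [homDim_quotient_add k (LinearMap.ker q),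
    homDim_congr_right k (q.quotKerEquivOfSurjective hq), homDim_projectiveCover k hL hP,
    HasFiltration.induction (motive := fun M _ _ => homDim k R (P l) M = 0) ?_ ?_ ?_ hker, zero_add]
  · intro M _ _ _
    exact homDim_eq_zero_of_forall k fun f => LinearMap.ext fun x => Subsingleton.elim _ _
  · intro M M' _ _ _ _ e h
    rw [← homDim_congr_right k e, h]
  · rintro M _ _ _ N _ ⟨t, ht, rfl⟩ e h
    rw [homDim_quotient_add k N, homDim_congr_right k e, homDim_projectiveCover k hL hP, h,
      if_neg (ht.trans_le hl).ne']

/-- The multiplicities of a module with a standard filtration, in terms of those of the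
standard modules. -/
theorem HasFiltration.exists_homDim_eq_sum (hL : IsFullSetOfSimples L)
    (hP : ∀ i, IsProjectiveCover (P i) (L i)) {i : Fin n}
    {M : Type u} [AddCommGroup M] [Module R M] [Module.Finite R M]
    (h : HasFiltration {X | ∃ j, i < j ∧ X = Δ j} M) :
    ∃ a : Fin n → ℕ, (∀ j ≤ i, a j = 0) ∧
      ∀ l, homDim k R (P l) M = ∑ j, a j * homDim k R (P l) (Δ j) := by
  refine HasFiltration.induction (motive := fun M _ _ => ∃ a : Fin n → ℕ, (∀ j ≤ i, a j = 0) ∧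
      ∀ l, homDim k R (P l) M = ∑ j, a j * homDim k R (P l) (Δ j)) ?_ ?_ ?_ h
  · intro M _ _ _
    refine ⟨0, fun _ _ => rfl, fun l => ?_⟩
    rw [homDim_eq_zero_of_forall k fun f => LinearMap.ext fun x => Subsingleton.elim _ _]
    simp
  · rintro M M' _ _ _ _ e ⟨a, ha, h⟩
    exact ⟨a, ha, fun l => by rw [← homDim_congr_right k e, h]⟩
  · rintro M _ _ _ N _ ⟨t, ht, rfl⟩ e ⟨a, ha, h⟩
    refine ⟨a + Pi.single t 1, fun j hj => ?_, fun l => ?_⟩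
    · simp [ha j hj, (hj.trans_lt ht).ne]
    · have := hL.simple l
      have := (hP l).finite
      have := (hP l).1
      rw [homDim_quotient_add k N, homDim_congr_right k e, h]
      simp [add_mul, Finset.sum_add_distrib, Pi.single_apply]

theorem exists_cartan_eq_sum (hL : IsFullSetOfSimples L)
    (hP : ∀ i, IsProjectiveCover (P i) (L i)) {i : Fin n} [Module.Finite R (P i)]
    {p : P i →ₗ[R] Δ i} (hp : Function.Surjective p)
    (h : HasFiltration {X | ∃ j, i < j ∧ X = Δ j} (LinearMap.ker p)) :
    ∃ a : Fin n → ℕ, a i = 1 ∧ (∀ j < i, a j = 0) ∧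
      ∀ l, homDim k R (P l) (P i) = ∑ j, a j * homDim k R (P l) (Δ j) := by
  obtain ⟨a, ha, hs⟩ := h.exists_homDim_eq_sum k hL hP
  refine ⟨a + Pi.single i 1, by simp [ha i le_rfl], fun j hj => by simp [ha j hj.le, hj.ne],
    fun l => ?_⟩
  have := hL.simple l
  have := (hP l).finite
  have := (hP l).1
  rw [homDim_quotient_add k (LinearMap.ker p),
    homDim_congr_right k (p.quotKerEquivOfSurjective hp), hs]
  simp [add_mul, Finset.sum_add_distrib, Pi.single_apply]

/-- In a module `M` without composition factors above `L j`, a standard subquotient `Δ j` at the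
top of a filtration splits off, since homomorphisms from the projective cover `Q` of `L j` to `M`
factor through `Δ j`. -/
theorem exists_section_of_standard {Q D : Type u} [AddCommGroup Q] [Module R Q]
    [Module.Projective R Q] [Module.Finite R Q] [AddCommGroup D] [Module R D] {p : Q →ₗ[R] D}
    (hp : Function.Surjective p) {S : Set (ModuleCat.{u} R)}
    (hS : HasFiltration S (LinearMap.ker p)) {M : Type u} [AddCommGroup M] [Module R M]
    (hM : ∀ X ∈ S, ∀ f : X →ₗ[R] M, f = 0) (N : Submodule R M) (e : (M ⧸ N) ≃ₗ[R] D) :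
    ∃ g : D →ₗ[R] M, ∀ x, e (N.mkQ (g x)) = x := by
  have hker : ∀ f : LinearMap.ker p →ₗ[R] M, f = 0 := by
    refine HasFiltration.induction (motive := fun K _ _ => ∀ f : K →ₗ[R] M, f = 0) ?_ ?_ ?_ hS
    · intro K _ _ _ f
      ext x
      rw [Subsingleton.elim x 0, map_zero, map_zero]
    · intro K K' _ _ _ _ e h f
      ext x
      simpa using LinearMap.congr_fun (h (f.comp (e : K →ₗ[R] K'))) (e.symm x)
    · intro K _ _ _ K' X hX e h f
      have h1 : K' ≤ LinearMap.ker f := fun x hx =>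
        LinearMap.congr_fun (h (f.comp K'.subtype)) ⟨x, hx⟩
      have h2 := hM X hX ((K'.liftQ f h1).comp (e.symm : X →ₗ[R] _))
      ext x
      simpa using LinearMap.congr_fun h2 (e (K'.mkQ x))
  obtain ⟨h, hh⟩ := Module.projective_lifting_property N.mkQ
    ((e.symm : D →ₗ[R] M ⧸ N).comp p) N.mkQ_surjective
  have hle : LinearMap.ker p ≤ LinearMap.ker h := fun x hx =>
    LinearMap.congr_fun (hker (h.comp (LinearMap.ker p).subtype)) ⟨x, hx⟩
  refine ⟨((LinearMap.ker p).liftQ h hle).comp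
    ((p.quotKerEquivOfSurjective hp).symm : D →ₗ[R] _), fun x => ?_⟩
  obtain ⟨y, rfl⟩ := hp x
  have h1 : (p.quotKerEquivOfSurjective hp).symm (p y) = (LinearMap.ker p).mkQ y := by
    rw [LinearEquiv.symm_apply_eq]
    rfl
  have h2 := LinearMap.congr_fun hh y
  simp only [LinearMap.comp_apply, LinearEquiv.coe_coe] at h2 ⊢
  have h3 : (LinearMap.ker p).liftQ h hle ((LinearMap.ker p).mkQ y) = h y := rfl
  rw [h1, h3, h2, LinearEquiv.apply_symm_apply]

/-- In a module with a standard filtration and without composition factors above `L j`, the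
standard modules `Δ j` of the filtration are submodules. -/
theorem standard_embeds (hL : IsFullSetOfSimples L)
    (hP : ∀ i, IsProjectiveCover (P i) (L i))
    (hΔ : ∀ i, ∃ p : P i →ₗ[R] Δ i, Function.Surjective p ∧
      HasFiltration {X | ∃ j, i < j ∧ X = Δ j} (LinearMap.ker p))
    (hD : ∀ j l, j ≤ l → homDim k R (P l) (Δ j) = if l = j then 1 else 0) (j i : Fin n)
    (hi : ∀ l, j < l → homDim k R (P l) (P i) = 0) :
    (homDim k R (P j) (P i) ≠ 0 → ∃ f : Δ j →ₗ[R] P i, Function.Injective f) ∧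
    (1 < homDim k R (P j) (P i) → ∃ N₁ N₂ : Submodule R (P i), N₁ ≠ ⊥ ∧ N₂ ≠ ⊥ ∧
      Disjoint N₁ N₂) := by
  have hfin : ∀ i, Module.Finite R (P i) := fun i => by
    have := hL.simple i
    exact (hP i).finite
  have hproj : ∀ i, Module.Projective R (P i) := fun i => (hP i).1
  let motive : ∀ (M : Type u) [AddCommGroup M] [Module R M], Prop := fun M _ _ =>
    (∀ l, j < l → homDim k R (P l) M = 0) →
    (homDim k R (P j) M ≠ 0 → ∃ f : Δ j →ₗ[R] M, Function.Injective f) ∧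
    (1 < homDim k R (P j) M → ∃ N₁ N₂ : Submodule R M, N₁ ≠ ⊥ ∧ N₂ ≠ ⊥ ∧ Disjoint N₁ N₂)
  have step : ∀ (M : Type u) [AddCommGroup M] [Module R M] [Module.Finite R M]
      (N : Submodule R M) (t : Fin n), ((M ⧸ N) ≃ₗ[R] Δ t) → motive N → motive M := by
    intro M _ _ _ N t e ih hM
    have hadd : ∀ l, homDim k R (P l) M = homDim k R (P l) N + homDim k R (P l) (Δ t) :=
      fun l => by rw [homDim_quotient_add k N, homDim_congr_right k e]
    have hN := ih fun l hl => by
      have := hM l hl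
      rw [hadd] at this
      omega
    have htj : t ≤ j := by
      by_contra! h
      have := hM t h
      rw [hadd, hD t t le_rfl, if_pos rfl] at this
      omega
    rcases htj.lt_or_eq with htj | rfl
    · rw [hadd, hD t j htj.le, if_neg htj.ne', add_zero]
      refine ⟨fun h => ?_, fun h => ?_⟩
      · obtain ⟨f, hf⟩ := hN.1 h
        exact ⟨N.subtype.comp f, N.injective_subtype.comp hf⟩
      · obtain ⟨N₁, N₂, h1, h2, h3⟩ := hN.2 h
        refine ⟨N₁.map N.subtype, N₂.map N.subtype, ?_, ?_, ?_⟩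
        · exact fun h => h1 (Submodule.map_injective_of_injective N.injective_subtype (by simpa using h))
        · exact fun h => h2 (Submodule.map_injective_of_injective N.injective_subtype (by simpa using h))
        · exact Submodule.disjoint_map N.injective_subtype h3
    · obtain ⟨p, hp, hfil⟩ := hΔ t
      obtain ⟨g, hg⟩ := exists_section_of_standard hp hfil (M := M) (by
        rintro X ⟨l, hl, rfl⟩ f
        obtain ⟨q, hq, -⟩ := hΔ l
        have h0 := (homDim_eq_zero_iff k).1 (hM l hl) (f.comp q)
        ext x
        obtain ⟨y, rfl⟩ := hq x
        exact LinearMap.congr_fun h0 y) N e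
      have hginj : Function.Injective g := fun x y hxy => by rw [← hg x, ← hg y, hxy]
      refine ⟨fun _ => ⟨g, hginj⟩, fun h => ?_⟩
      rw [hadd, hD t t le_rfl, if_pos rfl] at h
      obtain ⟨f, hf⟩ := hN.1 (by omega)
      have hne : ∀ f : Δ t →ₗ[R] M, Function.Injective f → LinearMap.range f ≠ ⊥ := by
        intro f hf h0
        have h1 : ∀ φ : P t →ₗ[R] Δ t, φ = 0 := fun φ => by
          ext x
          apply hf
          rw [LinearMap.range_eq_bot.1 h0]
          rfl
        have := hD t t le_rfl
        rw [homDim_eq_zero_of_forall k h1, if_pos rfl] at this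
        omega
      refine ⟨_, _, hne (N.subtype.comp f) (N.injective_subtype.comp hf), hne g hginj, ?_⟩
      rw [Submodule.disjoint_def]
      rintro _ ⟨x, rfl⟩ ⟨y, hy⟩
      have h1 := hg y
      rw [hy] at h1
      have h2 : N.mkQ ((N.subtype.comp f) x) = 0 := by simp
      rw [h2, map_zero] at h1
      rw [← hy, ← h1, map_zero]
  obtain ⟨p, hp, hfil⟩ := hΔ i
  refine step (P i) (LinearMap.ker p) i (p.quotKerEquivOfSurjective hp) ?_ hi
  refine HasFiltration.induction (motive := motive) ?_ ?_ ?_ hfil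
  · intro M _ _ _ _
    rw [homDim_eq_zero_of_forall k fun f => LinearMap.ext fun x => Subsingleton.elim _ _]
    simp
  · intro M M' _ _ _ _ e ih hM'
    have hM := ih fun l hl => by rw [homDim_congr_right k e, hM' l hl]
    rw [← homDim_congr_right k e]
    refine ⟨fun h => ?_, fun h => ?_⟩
    · obtain ⟨f, hf⟩ := hM.1 h
      exact ⟨(e : M →ₗ[R] M').comp f, e.injective.comp hf⟩
    · obtain ⟨N₁, N₂, h1, h2, h3⟩ := hM.2 h
      refine ⟨N₁.map (e : M →ₗ[R] M'), N₂.map (e : M →ₗ[R] M'), ?_, ?_, ?_⟩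
      · exact fun h => h1 (Submodule.map_injective_of_injective e.injective (by simpa using h))
      · exact fun h => h2 (Submodule.map_injective_of_injective e.injective (by simpa using h))
      · exact Submodule.disjoint_map (f := (e : M →ₗ[R] M')) e.injective h3
  · rintro M _ _ _ N _ ⟨t, -, rfl⟩ e ih
    exact step M N t e ih

end Filtration

/-! ### The Cartan matrix -/

section Cartan

variable {R : Type u} [Ring R]
variable {n : ℕ} {L P : Fin n → ModuleCat.{u} R}

/-- A nonzero module embeds in two modules with simple socles only if these socles are
isomorphic. -/
theorem HasSimpleSocle.eq_of_embeds (hL : IsFullSetOfSimples L) {i j : Fin n} {A B X : Type u}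
    [AddCommGroup A] [Module R A] [AddCommGroup B] [Module R B] [AddCommGroup X] [Module R X]
    [IsArtinian R X] [Nontrivial X] (hA : HasSimpleSocle R (L i) A) (hB : HasSimpleSocle R (L j) B)
    {f : X →ₗ[R] A} (hf : Function.Injective f) {g : X →ₗ[R] B} (hg : Function.Injective g) :
    i = j := by
  obtain ⟨t, φ, hφ⟩ := hL.exists_injective X
  have key : ∀ {i : Fin n} {A : Type u} [AddCommGroup A] [Module R A],
      HasSimpleSocle R (L i) A → ∀ {f : X →ₗ[R] A}, Function.Injective f → t = i := by
    rintro i A _ _ ⟨σ, hσ, hN⟩ f hf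
    have := hL.simple i
    have := hL.simple t
    have := IsSimpleModule.nontrivial R (L i)
    have := IsSimpleModule.nontrivial R (L t)
    obtain ⟨g, hg⟩ := HasSimpleSocle.exists_comp hN hσ (f.comp φ)
    by_contra hti
    rcases LinearMap.bijective_or_eq_zero g with h | h
    · exact (hL.not_iso t i hti).false (LinearEquiv.ofBijective g h)
    · obtain ⟨y, hy⟩ := exists_ne (0 : L t)
      rw [h, LinearMap.comp_zero] at hg
      exact hy (hφ (hf (by
        rw [map_zero, map_zero]
        exact (LinearMap.congr_fun hg y).symm)))
  rw [← key hA hf, key hB hg]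

/-- The rows of a product of a unitriangular and a lower unitriangular matrix are distinct. -/
theorem eq_of_sum_mul_eq {a d : Fin n → Fin n → ℕ} (ha : ∀ i, a i i = 1)
    (ha' : ∀ i j, j < i → a i j = 0) (hd : ∀ i, d i i = 1) (hd' : ∀ i j, i < j → d i j = 0)
    {i s : Fin n} (h : ∀ l, ∑ j, a i j * d j l = ∑ j, a s j * d j l) : i = s := by
  have key : ∀ m : ℕ, ∀ l : Fin n, n - l.val = m → a i l = a s l := by
    intro m
    induction m using Nat.strong_induction_on with
    | _ m ih =>
      intro l hl
      have h1 : ∀ x, ∑ j, a x j * d j l =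
          a x l + ∑ j ∈ Finset.univ.erase l, a x j * d j l := fun x => by
        rw [← Finset.add_sum_erase _ _ (Finset.mem_univ l), hd, mul_one]
      have h2 : ∑ j ∈ Finset.univ.erase l, a i j * d j l =
          ∑ j ∈ Finset.univ.erase l, a s j * d j l := by
        refine Finset.sum_congr rfl fun j hj => ?_
        rcases lt_or_gt_of_ne (Finset.ne_of_mem_erase hj) with hjl | hjl
        · rw [hd' j l hjl, mul_zero, mul_zero]
        · rw [ih (n - j.val) (by omega) j rfl]
      have h3 := h l
      rw [h1, h1, h2] at h3
      exact Nat.add_right_cancel h3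
  rcases lt_trichotomy i s with his | his | his
  · have := key _ i rfl
    rw [ha, ha' s i his] at this
    omega
  · exact his
  · have := key _ s rfl
    rw [ha, ha' i s his] at this
    omega

variable (k : Type*) [Field k] [IsAlgClosed k] [Algebra k R] [Module.Finite k R]
  [IsArtinianRing R]

/-- The multiplicities in a quasi-hereditary algebra: the Cartan matrix is the product of the
unitriangular matrices of the multiplicities of standard modules in projective modules and of
simple modules in standard modules. -/
theorem IsQuasiHereditary.exists_decomposition (hL : IsFullSetOfSimples L)
    (hP : ∀ i, IsProjectiveCover (P i) (L i)) (h : IsQuasiHereditary L P) :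
    ∃ (Δ : Fin n → ModuleCat.{u} R) (a : Fin n → Fin n → ℕ),
      (∀ i, Module.Finite R (Δ i)) ∧
      (∀ i, ∃ p : P i →ₗ[R] Δ i, Function.Surjective p ∧
        HasFiltration {X | ∃ j, i < j ∧ X = Δ j} (LinearMap.ker p)) ∧
      (∀ j l, j ≤ l → homDim k R (P l) (Δ j) = if l = j then 1 else 0) ∧
      (∀ i, a i i = 1) ∧ (∀ i j, j < i → a i j = 0) ∧
      ∀ i l, homDim k R (P l) (P i) = ∑ j, a i j * homDim k R (P l) (Δ j) := by
  obtain ⟨Δ, hΔ, hΔ'⟩ := h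
  have hfin : ∀ i, Module.Finite R (P i) := fun i => by
    have := hL.simple i
    exact (hP i).finite
  have hfinΔ : ∀ i, Module.Finite R (Δ i) := fun i => by
    obtain ⟨p, hp, -⟩ := hΔ i
    exact Module.Finite.of_surjective p hp
  have ha : ∀ i, ∃ a : Fin n → ℕ, a i = 1 ∧ (∀ j < i, a j = 0) ∧
      ∀ l, homDim k R (P l) (P i) = ∑ j, a j * homDim k R (P l) (Δ j) := fun i => by
    obtain ⟨p, hp, h⟩ := hΔ i
    exact exists_cartan_eq_sum k hL hP hp h
  choose a ha1 ha2 ha3 using ha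
  refine ⟨Δ, a, hfinΔ, hΔ, fun j l hl => ?_, ha1, ha2, ha3⟩
  obtain ⟨q, hq, h⟩ := hΔ' j
  exact homDim_standard k hL hP hq h hl

/-- If the Cartan matrix is symmetric, then an injective `P i` has socle `L i`: if the socle is
`L s`, then the rows of the Cartan matrix at `i` and `s` agree. -/
theorem hasSimpleSocle_of_injective (hL : IsFullSetOfSimples L)
    (hP : ∀ i, IsProjectiveCover (P i) (L i)) (h : IsQuasiHereditary L P)
    (hsymm : ∀ i j, homDim k R (P i) (P j) = homDim k R (P j) (P i)) {i : Fin n}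
    (hI : Module.Injective R (P i)) : HasSimpleSocle R (L i) (P i) := by
  have hfin : ∀ i, Module.Finite R (P i) := fun i => by
    have := hL.simple i
    exact (hP i).finite
  obtain ⟨s, hs⟩ := (hP i).exists_hasSimpleSocle hL hI
  obtain ⟨Δ, a, -, -, hD, ha1, ha2, ha3⟩ := h.exists_decomposition k hL hP
  have his : i = s := by
    refine eq_of_sum_mul_eq (d := fun j l => homDim k R (P l) (Δ j)) ha1 ha2
      (fun j => by simp [hD j j le_rfl]) (fun j l hjl => by simp [hD j l hjl.le, hjl.ne'])
      fun l => ?_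
    rw [← ha3, ← ha3, homDim_to_injective k hL hP hI hs, hsymm]
  rwa [← his] at hs

/-- If `P i` has socle `L i`, and `L i` has multiplicity one in it, then `P i` is simple. -/
theorem homDim_eq_zero_of_hasSimpleSocle (hL : IsFullSetOfSimples L)
    (hP : ∀ i, IsProjectiveCover (P i) (L i)) {i : Fin n}
    (hs : HasSimpleSocle R (L i) (P i)) (hone : homDim k R (P i) (P i) = 1) {j : Fin n}
    (hji : j ≠ i) : homDim k R (P j) (P i) = 0 := by
  have := hL.simple i
  have := (hP i).finite
  have := (hP i).1
  obtain ⟨-, p, hp, -⟩ := hP i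
  have e := p.quotKerEquivOfSurjective hp
  have h1 := homDim_quotient_add k (M := P i) (LinearMap.ker p)
  rw [homDim_congr_right k e, homDim_projectiveCover k hL hP, if_pos rfl, hone] at h1
  have hker : LinearMap.ker p = ⊥ := by
    by_contra hne
    obtain ⟨σ, hσ, hN⟩ := hs
    have : Module.Finite R (L i) := Module.Finite.of_surjective p hp
    have h2 := homDim_le_of_injective k (M := P i)
      (f := σ.codRestrict (LinearMap.ker p) fun x => hN _ hne ⟨x, rfl⟩)
      fun x y h => hσ (congrArg Subtype.val h)
    rw [homDim_projectiveCover k hL hP, if_pos rfl] at h2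
    omega
  rw [homDim_congr_right k (LinearEquiv.ofBijective p ⟨LinearMap.ker_eq_bot.1 hker, hp⟩),
    homDim_projectiveCover k hL hP, if_neg hji]

/-- The largest projective module is standard. -/
theorem homDim_last (hL : IsFullSetOfSimples L) (hP : ∀ i, IsProjectiveCover (P i) (L i))
    (h : IsQuasiHereditary L P) {i : Fin n} (hi : i.val + 1 = n) :
    homDim k R (P i) (P i) = 1 := by
  obtain ⟨Δ, a, -, -, hD, ha1, ha2, ha3⟩ := h.exists_decomposition k hL hP
  rw [ha3, Finset.sum_eq_single i, ha1, hD i i le_rfl, if_pos rfl]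
  · intro j _ hj
    rw [ha2 i j (by omega), zero_mul]
  · simp

/-- The Cartan matrix, if it is symmetric, and if all `P i` except for the last one are not simple
and have socle `L i`. -/
theorem cartan_eq (hL : IsFullSetOfSimples L) (hP : ∀ i, IsProjectiveCover (P i) (L i))
    (h : IsQuasiHereditary L P)
    (hsymm : ∀ i j, homDim k R (P i) (P j) = homDim k R (P j) (P i))
    (hsoc : ∀ i : Fin n, i.val + 1 < n → HasSimpleSocle R (L i) (P i))
    (htwo : ∀ i : Fin n, i.val + 1 < n → homDim k R (P i) (P i) ≠ 1) (i j : Fin n) :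
    homDim k R (P i) (P j) =
      if i = j then (if i.val + 1 < n then 2 else 1)
      else if i.val + 1 = j.val ∨ j.val + 1 = i.val then 1 else 0 := by
  obtain ⟨Δ, a, hfin, hΔ, hD, ha1, ha2, ha3⟩ := h.exists_decomposition k hL hP
  -- The standard module `Δ j` has the composition factors `L j` and `L (j - 1)`.
  have key : ∀ m : ℕ, ∀ j : Fin n, n - j.val = m →
      ∀ i : Fin n, (i.val + 1 < j.val → homDim k R (P i) (Δ j) = 0 ∧ homDim k R (P j) (P i) = 0) ∧
        (i.val + 1 = j.val → homDim k R (P i) (Δ j) = 1 ∧ homDim k R (P j) (P i) = 1) := by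
    intro m
    induction m using Nat.strong_induction_on with
    | _ m ih =>
      intro j hj
      have ih' : ∀ j' : Fin n, j < j' → ∀ i : Fin n, i < j →
          homDim k R (P i) (Δ j') = 0 ∧ homDim k R (P j') (P i) = 0 :=
        fun j' hj' i hi => (ih (n - j'.val) (by omega) j' rfl i).1 (by omega)
      -- Reciprocity at `j`, since only `Δ j` contributes `L i` to `P j`.
      have hrec : ∀ i : Fin n, i < j → homDim k R (P i) (Δ j) = homDim k R (P j) (P i) := by
        intro i hi
        rw [hsymm j i, ha3, Finset.sum_eq_single j, ha1, one_mul]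
        · intro j' _ hj'
          rcases lt_or_gt_of_ne hj' with h' | h'
          · rw [ha2 j j' h', zero_mul]
          · rw [(ih' j' h' i hi).1, mul_zero]
        · simp
      have hemb : ∀ i : Fin n, i < j → _ := fun i hi =>
        standard_embeds k hL hP hΔ hD j i fun l hl => (ih' l hl i hi).2
      have hone : ∀ i : Fin n, i.val + 1 = j.val → homDim k R (P j) (P i) = 1 := by
        intro i hi
        have hij : i < j := by omega
        refine le_antisymm ?_ ?_
        · by_contra! hlt
          obtain ⟨N₁, N₂, h1, h2, h3⟩ := (hemb i hij).2 hlt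
          obtain ⟨σ, hσ, hN⟩ := hsoc i (by omega)
          have := hL.simple i
          have := IsSimpleModule.nontrivial R (L i)
          obtain ⟨y, hy⟩ := exists_ne (0 : L i)
          refine hy (hσ ?_)
          rw [map_zero]
          exact Submodule.disjoint_def.1 h3 _ (hN _ h1 ⟨y, rfl⟩) (hN _ h2 ⟨y, rfl⟩)
        · rw [Nat.one_le_iff_ne_zero]
          intro h0
          refine htwo i (by omega) ?_
          rw [ha3, Finset.sum_eq_single i, ha1, hD i i le_rfl, if_pos rfl]
          · intro j' _ hj'
            rcases lt_or_gt_of_ne hj' with h' | h'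
            · rw [ha2 i j' h', zero_mul]
            · have hzero : homDim k R (P j') (P i) = 0 := by
                rcases (show j ≤ j' by omega).eq_or_lt with h'' | h''
                · rwa [← h'']
                · exact (ih' j' h'' i hij).2
              rw [ha3, Finset.sum_eq_zero_iff] at hzero
              have := hzero j' (Finset.mem_univ _)
              rw [hD j' j' le_rfl, if_pos rfl, mul_one] at this
              rw [this, zero_mul]
          · simp
      refine fun i => ⟨fun hi => ?_, fun hi => ?_⟩
      · rw [hrec i (by omega), and_self]
        by_contra hne
        have : Nontrivial (Δ j) := by
          by_contra hnt
          rw [not_nontrivial_iff_subsingleton] at hnt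
          have := hD j j le_rfl
          rw [homDim_eq_zero_of_forall k fun f =>
            LinearMap.ext fun x => Subsingleton.elim _ _, if_pos rfl] at this
          omega
        obtain ⟨f, hf⟩ := (hemb i (by omega)).1 hne
        let i' : Fin n := ⟨j.val - 1, by omega⟩
        obtain ⟨g, hg⟩ := (hemb i' (by simp only [i', Fin.lt_def]; omega)).1 (by
          rw [hone i' (by simp only [i']; omega)]
          exact one_ne_zero)
        have := congrArg Fin.val ((hsoc i (by omega)).eq_of_embeds hL
          (hsoc i' (by simp only [i']; omega)) hf hg)
        simp only [i'] at this
        omega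
      · rw [hrec i (by omega), and_self]
        exact hone i hi
  have key' : ∀ i j : Fin n, i < j →
      homDim k R (P j) (P i) = if i.val + 1 = j.val then 1 else 0 := by
    intro i j hij
    split_ifs with h1
    · exact ((key _ j rfl i).2 h1).2
    · exact ((key _ j rfl i).1 (by omega)).2
  rcases lt_trichotomy i j with hij | hij | hij
  · rw [hsymm, key' i j hij, if_neg hij.ne]
    refine if_congr ?_ rfl rfl
    omega
  · subst hij
    rw [if_pos rfl]
    split_ifs with hi
    · refine le_antisymm ?_ ?_
      · let j : Fin n := ⟨i.val + 1, hi⟩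
        have hij : i < j := by simp [j, Fin.lt_def]
        have haj : a i j ≤ 1 := by
          have h1 := ((key _ j rfl i).2 rfl).2
          rw [ha3] at h1
          have h2 := Finset.single_le_sum (f := fun t => a i t * homDim k R (P j) (Δ t))
            (fun _ _ => Nat.zero_le _) (Finset.mem_univ j)
          simp only [hD j j le_rfl, if_pos, mul_one] at h2
          exact h2.trans h1.le
        rw [ha3, Finset.sum_eq_add_of_mem i j (Finset.mem_univ _) (Finset.mem_univ _) hij.ne,
          ha1, hD i i le_rfl, if_pos rfl, ((key _ j rfl i).2 rfl).1]
        · omega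
        · rintro t - ⟨ht1, ht2⟩
          rcases lt_or_gt_of_ne ht1 with h' | h'
          · rw [ha2 i t h', zero_mul]
          · have : t.val ≠ i.val + 1 := fun h => ht2 (Fin.ext h)
            rw [((key _ t rfl i).1 (by omega)).1, mul_zero]
      · have h1 := htwo i hi
        have h2 := Finset.single_le_sum (f := fun t => a i t * homDim k R (P i) (Δ t))
            (fun _ _ => Nat.zero_le _) (Finset.mem_univ i)
        rw [← ha3] at h2
        simp only [hD i i le_rfl, if_pos, mul_one, ha1] at h2
        omega
    · exact homDim_last k hL hP h (by omega)
  · rw [key' j i hij, if_neg hij.ne']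
    refine if_congr ?_ rfl rfl
    omega

end Cartan

/-! ### Idempotents and projective modules -/

section Idempotent

open MulOpposite

variable {Λ : Type u} [Ring Λ]

/-- The right module `e Λ`, for `e : Λ`. -/
abbrev rightIdeal (e : Λ) : Submodule Λᵐᵒᵖ Λ := Submodule.span Λᵐᵒᵖ {e}

theorem mem_rightIdeal {e x : Λ} : x ∈ rightIdeal e ↔ ∃ y, e * y = x := by
  rw [Submodule.mem_span_singleton]
  exact ⟨fun ⟨a, ha⟩ => ⟨unop a, ha⟩, fun ⟨y, hy⟩ => ⟨op y, hy⟩⟩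

theorem mul_eq_of_mem_rightIdeal {e x : Λ} (he : IsIdempotentElem e) (hx : x ∈ rightIdeal e) :
    e * x = x := by
  obtain ⟨y, rfl⟩ := mem_rightIdeal.1 hx
  rw [← mul_assoc, he.eq]

/-- The idempotent `e`, as the generator of `e Λ`. -/
def rightIdeal.gen (e : Λ) : rightIdeal e := ⟨e, Submodule.mem_span_singleton_self e⟩

theorem rightIdeal.smul_gen {e : Λ} (he : IsIdempotentElem e) (x : rightIdeal e) :
    op (x : Λ) • rightIdeal.gen e = x :=
  Subtype.ext (mul_eq_of_mem_rightIdeal he x.2)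

/-- Regular right modules are free of rank one. -/
def opLinearEquivSelf (Λ : Type u) [Ring Λ] : Λᵐᵒᵖ ≃ₗ[Λᵐᵒᵖ] Λ where
  toFun := unop
  invFun := op
  left_inv _ := rfl
  right_inv _ := rfl
  map_add' _ _ := rfl
  map_smul' _ _ := rfl

variable {M : Type*} [AddCommGroup M] [Module Λᵐᵒᵖ M]

/-- The homomorphism `e Λ → M` that acts on a given element of `M`. -/
def rightIdeal.lift {e : Λ} (m : M) : rightIdeal e →ₗ[Λᵐᵒᵖ] M where
  toFun x := op (x : Λ) • m
  map_add' x y := by simp [add_smul]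
  map_smul' a x := by
    rw [RingHom.id_apply, ← mul_smul]
    rfl

theorem rightIdeal.apply_eq {e : Λ} (he : IsIdempotentElem e) (f : rightIdeal e →ₗ[Λᵐᵒᵖ] M)
    (x : rightIdeal e) : f x = op (x : Λ) • f (rightIdeal.gen e) := by
  rw [← map_smul, rightIdeal.smul_gen he]

theorem rightIdeal.projective {e : Λ} (he : IsIdempotentElem e) :
    Module.Projective Λᵐᵒᵖ (rightIdeal e) := by
  have : Module.Projective Λᵐᵒᵖ Λ := Module.Projective.of_equiv (opLinearEquivSelf Λ)
  let s : Λ →ₗ[Λᵐᵒᵖ] rightIdeal e :=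
    { toFun := fun x => ⟨e * x, mem_rightIdeal.2 ⟨x, rfl⟩⟩
      map_add' := fun x y => Subtype.ext (mul_add e x y)
      map_smul' := fun a x => Subtype.ext (mul_assoc e x (unop a)).symm }
  refine Module.Projective.of_split (rightIdeal e).subtype s ?_
  ext x
  exact mul_eq_of_mem_rightIdeal he x.2

variable {n : ℕ} {L P : Fin n → ModuleCat.{u} Λᵐᵒᵖ}

/-- The projective module defined by a primitive idempotent is the projective cover of a simple
module `L j`: the covering map lifts to a split surjection to `P j`, and a splitting corresponds
to a decomposition of the idempotent. -/
theorem IsPrimitiveIdem.exists_equiv (hL : IsFullSetOfSimples L)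
    (hP : ∀ i, IsProjectiveCover (P i) (L i)) {e : Λ} (he : IsPrimitiveIdem e) :
    ∃ j, Nonempty (rightIdeal e ≃ₗ[Λᵐᵒᵖ] P j) := by
  obtain ⟨hidem, hne, hprim⟩ := he
  have := rightIdeal.projective hidem
  have : Nontrivial (rightIdeal e) :=
    ⟨⟨rightIdeal.gen e, 0, fun h => hne (congrArg Subtype.val h)⟩⟩
  obtain ⟨j, q, hq⟩ := hL.exists_surjective (rightIdeal e)
  have := hL.simple j
  have := (hP j).nontrivial
  obtain ⟨_, p, hp, hmax⟩ := hP j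
  obtain ⟨h, hh⟩ := Module.projective_lifting_property p q hp
  have hsurj : Function.Surjective h := by
    rw [← LinearMap.range_eq_top]
    apply hmax
    rw [← Submodule.comap_map_eq, ← LinearMap.range_comp, hh, LinearMap.range_eq_top.2 hq,
      Submodule.comap_top]
  obtain ⟨s, hs⟩ := Module.projective_lifting_property h LinearMap.id hsurj
  have hs' : ∀ x, h (s x) = x := fun x => LinearMap.congr_fun hs x
  set f : rightIdeal e := s (h (rightIdeal.gen e)) with hf
  have hπ : ∀ x : rightIdeal e, (s (h x) : Λ) = f * x := fun x => by
    have := rightIdeal.apply_eq hidem (s.comp h) x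
    exact congrArg Subtype.val this
  have h1 : e * f = f := mul_eq_of_mem_rightIdeal hidem f.2
  have h2 : (f : Λ) * e = f := (hπ (rightIdeal.gen e)).symm
  have h3 : (f : Λ) * f = f := by
    rw [← hπ f, hf, hs']
  refine ⟨j, ⟨LinearEquiv.ofBijective h ⟨?_, hsurj⟩⟩⟩
  rcases hprim f (e - f) h3 (by
      rw [IsIdempotentElem, mul_sub, sub_mul, sub_mul, hidem.eq, h1, h2, h3]
      abel) (by rw [mul_sub, h2, h3, sub_self]) (by rw [sub_mul, h1, h3, sub_self])
    (by abel) with h0 | h0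
  · exfalso
    obtain ⟨y, hy⟩ := exists_ne (0 : P j)
    obtain ⟨x, rfl⟩ := hsurj y
    refine hy ?_
    have : s (h x) = 0 := Subtype.ext (by rw [hπ, h0, zero_mul]; rfl)
    rw [← hs' (h x), this, map_zero]
  · intro x y hxy
    have h5 : ∀ x : rightIdeal e, s (h x) = x := fun x => Subtype.ext (by
      rw [hπ, ← sub_eq_zero.1 h0, mul_eq_of_mem_rightIdeal hidem x.2])
    rw [← h5 x, ← h5 y, hxy]

/-- In a basic algebra there are primitive idempotents `e i` with `e i Λ` isomorphic to the given
projective covers of the simple modules. -/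
theorem IsBasicAlg.exists_idempotents (hbasic : IsBasicAlg Λ) (k : Type*) [Field k]
    [IsAlgClosed k] [Algebra k Λ] [Module.Finite k Λ] (hL : IsFullSetOfSimples L)
    (hP : ∀ i, IsProjectiveCover (P i) (L i)) :
    ∃ e : Fin n → Λ, CompleteOrthogonalIdempotents e ∧ (∀ i, IsPrimitiveIdem (e i)) ∧
      ∀ i, Nonempty (rightIdeal (e i) ≃ₗ[Λᵐᵒᵖ] P i) := by
  obtain ⟨m, e, he, hprim, hiso⟩ := hbasic
  choose τ hτ using fun i => (hprim i).exists_equiv hL hP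
  have hbij : Function.Bijective τ := by
    refine ⟨fun i j hij => ?_, fun j => ?_⟩
    · by_contra hne
      obtain ⟨a⟩ := hτ i
      obtain ⟨b⟩ := hτ j
      rw [← hij] at b
      exact (hiso i j hne).false (a.trans b.symm)
    · have := hL.simple j
      have := IsSimpleModule.nontrivial Λᵐᵒᵖ (L j)
      obtain ⟨y, hy⟩ := exists_ne (0 : L j)
      have h1 : ∃ i, op (e i) • y ≠ 0 := by
        by_contra! h
        refine hy ?_
        rw [← one_smul Λᵐᵒᵖ y, ← op_one, ← he.complete, Finset.op_sum, Finset.sum_smul]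
        exact Finset.sum_eq_zero fun i _ => h i
      obtain ⟨i, hi⟩ := h1
      refine ⟨i, ?_⟩
      obtain ⟨a⟩ := hτ i
      by_contra hne
      have h2 := homDim_projectiveCover k hL hP (τ i) j
      have := hL.simple (τ i)
      have := (hP (τ i)).finite
      have : Module.Finite Λᵐᵒᵖ (L j) := ⟨⟨{y}, by
        rw [Finset.coe_singleton]
        exact IsSimpleModule.span_singleton_eq_top Λᵐᵒᵖ hy⟩⟩
      rw [if_neg hne, homDim_eq_zero_iff] at h2
      have h3 := LinearMap.congr_fun
        (h2 ((rightIdeal.lift (e := e i) y).comp (a.symm : P (τ i) →ₗ[Λᵐᵒᵖ] _)))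
        (a (rightIdeal.gen (e i)))
      rw [LinearMap.comp_apply, LinearEquiv.coe_coe, LinearEquiv.symm_apply_apply] at h3
      exact hi h3
  let t := Equiv.ofBijective τ hbij
  refine ⟨e ∘ t.symm, (CompleteOrthogonalIdempotents.equiv t.symm).2 he, fun i => hprim _,
    fun i => ?_⟩
  obtain ⟨a⟩ := hτ (t.symm i)
  have hi : τ (t.symm i) = i := t.apply_symm_apply i
  rw [hi] at a
  exact ⟨a⟩

/-- The Peirce component `e Λ f`, for idempotents `e` and `f`. -/
def peirceComp (k : Type*) [Field k] {Λ : Type*} [Ring Λ] [Algebra k Λ] (e f : Λ) :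
    Submodule k Λ where
  carrier := {x | e * x = x ∧ x * f = x}
  add_mem' hx hy := ⟨by rw [mul_add, hx.1, hy.1], by rw [add_mul, hx.2, hy.2]⟩
  zero_mem' := ⟨mul_zero e, zero_mul f⟩
  smul_mem' c x hx := ⟨by rw [mul_smul_comm, hx.1], by rw [smul_mul_assoc, hx.2]⟩

theorem mem_peirceComp {k : Type*} [Field k] {Λ : Type*} [Ring Λ] [Algebra k Λ] {e f x : Λ} :
    x ∈ peirceComp k e f ↔ e * x = x ∧ x * f = x := Iff.rfl

attribute [local instance] homModule

theorem finrank_peirceComp (k : Type*) [Field k] [Algebra k Λ] {e f : Λ}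
    (he : IsIdempotentElem e) (hf : IsIdempotentElem f) :
    Module.finrank k (peirceComp k e f) = homDim k Λᵐᵒᵖ (rightIdeal f) (rightIdeal e) := by
  let φ : (rightIdeal f →ₗ[Λᵐᵒᵖ] rightIdeal e) →ₗ[k] peirceComp k e f :=
    { toFun := fun g => ⟨g (rightIdeal.gen f), mul_eq_of_mem_rightIdeal he (Subtype.prop _), by
        have := congrArg Subtype.val (rightIdeal.apply_eq hf g (rightIdeal.gen f))
        exact this.symm⟩
      map_add' := fun _ _ => rfl
      map_smul' := fun c g => by
        ext
        change (g (rightIdeal.gen f) : Λ) * algebraMap k Λ c = c • (g (rightIdeal.gen f) : Λ)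
        rw [Algebra.smul_def, Algebra.commutes] }
  refine (LinearEquiv.finrank_eq (LinearEquiv.ofBijective φ ⟨fun g h hgh => ?_, fun x => ?_⟩)).symm
  · ext y
    have h1 : g (rightIdeal.gen f) = h (rightIdeal.gen f) :=
      Subtype.ext (congrArg (fun t : peirceComp k e f => (t : Λ)) hgh)
    rw [rightIdeal.apply_eq hf g, rightIdeal.apply_eq hf h, h1]
  · refine ⟨rightIdeal.lift (⟨x, mem_rightIdeal.2 ⟨x, x.2.1⟩⟩ : rightIdeal e), ?_⟩
    exact Subtype.ext x.2.2

/-- If `e Λ` is isomorphic to a projective cover with simple socle isomorphic to the top, then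
every nonzero element of `e Λ` can be multiplied into `e Λ e` without vanishing. -/
theorem HasSimpleSocle.exists_mul_ne_zero {P L : ModuleCat.{u} Λᵐᵒᵖ}
    (hP : IsProjectiveCover P L) [IsSimpleModule Λᵐᵒᵖ L] (hs : HasSimpleSocle Λᵐᵒᵖ L P)
    {e : Λ} (he : IsIdempotentElem e) (a : rightIdeal e ≃ₗ[Λᵐᵒᵖ] P) {x : Λ} (hx : e * x = x)
    (hx0 : x ≠ 0) : ∃ y, x * y * e ≠ 0 := by
  obtain ⟨-, p, hp, -⟩ := hP
  obtain ⟨σ, hσ, hN⟩ := hs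
  let x' : rightIdeal e := ⟨x, mem_rightIdeal.2 ⟨x, hx⟩⟩
  have hx' : x' ≠ 0 := fun h => hx0 (congrArg Subtype.val h)
  let φ : rightIdeal e →ₗ[Λᵐᵒᵖ] P := (σ.comp p).comp (a : rightIdeal e →ₗ[Λᵐᵒᵖ] P)
  have hu : φ (rightIdeal.gen e) ≠ 0 := by
    intro h0
    have := IsSimpleModule.nontrivial Λᵐᵒᵖ L
    obtain ⟨y, hy⟩ := exists_ne (0 : L)
    obtain ⟨z, rfl⟩ := (hp.comp a.surjective) y
    refine hy (hσ ?_)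
    have h1 := rightIdeal.apply_eq he φ z
    rw [h0, smul_zero] at h1
    rw [map_zero]
    exact h1
  have hmem := hN (Submodule.span Λᵐᵒᵖ {a x'}) (by
    rw [Ne, Submodule.span_singleton_eq_bot]
    exact fun h => hx' (a.injective (by rw [h, map_zero])))
    ⟨p (a (rightIdeal.gen e)), rfl⟩
  obtain ⟨b, hb⟩ := Submodule.mem_span_singleton.1 hmem
  refine ⟨unop b, fun h0 => hu ?_⟩
  have h1 : op e • φ (rightIdeal.gen e) = φ (rightIdeal.gen e) :=
    (rightIdeal.apply_eq he φ (rightIdeal.gen e)).symm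
  have h2 : op e • b • x' = 0 := Subtype.ext h0
  have h3 : b • a x' = φ (rightIdeal.gen e) := hb
  rw [← h1, ← h3, ← map_smul, ← map_smul, h2, map_zero]

end Idempotent

/-! ### Zig-zag systems -/

section Zigzag

/-- Elements `e i`, `g i j` and `x i` of an algebra that satisfy the relations of the vertices,
the arrows and the loops of length two of the algebra `B_n`: the elements `g i j` only matter for
adjacent vertices `i` and `j` of the path graph, and `x i` is the common value of the products
`g i j * g j i`. -/
structure IsZigzagSystem {n : ℕ} {B : Type*} [Semiring B] (e : Fin n → B) (g : Fin n → Fin n → B)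
    (x : Fin n → B) : Prop where
  complete : CompleteOrthogonalIdempotents e
  left : ∀ i j, (SimpleGraph.pathGraph n).Adj i j → e i * g i j = g i j
  right : ∀ i j, (SimpleGraph.pathGraph n).Adj i j → g i j * e j = g i j
  cycle : ∀ i j, (SimpleGraph.pathGraph n).Adj i j → g i j * g j i = x i
  three : ∀ i j, (SimpleGraph.pathGraph n).Adj i j → x i * g i j = 0
  path : ∀ i j l, (SimpleGraph.pathGraph n).Adj i j → (SimpleGraph.pathGraph n).Adj j l →
    i ≠ l → g i j * g j l = 0
  last : ∀ i : Fin n, i.val + 1 = n → x i = 0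

theorem exists_pathGraph_adj {n : ℕ} (hn : 1 < n) (i : Fin n) :
    ∃ j, (SimpleGraph.pathGraph n).Adj i j := by
  simp only [SimpleGraph.pathGraph_adj]
  by_cases h : i.val + 1 < n
  · exact ⟨⟨i.val + 1, h⟩, Or.inl rfl⟩
  · exact ⟨⟨i.val - 1, by omega⟩, Or.inr (by simp only; omega)⟩

/-- The span of those elements of a zig-zag system that are paths from `i` to `j`. -/
def zigzagComp (k : Type*) [Field k] {n : ℕ} {B : Type*} [Semiring B] [Algebra k B] (e : Fin n → B)
    (g : Fin n → Fin n → B) (x : Fin n → B) (i j : Fin n) : Submodule k B :=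
  Submodule.span k {z | (i = j ∧ (z = e i ∨ z = x i)) ∨
    ((SimpleGraph.pathGraph n).Adj i j ∧ z = g i j)}

namespace IsZigzagSystem

variable {k : Type*} [Field k] {n : ℕ} {B : Type*} [Semiring B] [Algebra k B] {e : Fin n → B}
    {g : Fin n → Fin n → B} {x : Fin n → B}

theorem e_mul_x (h : IsZigzagSystem e g x) (hn : 1 < n) (i : Fin n) : e i * x i = x i := by
  obtain ⟨j, hj⟩ := exists_pathGraph_adj hn i
  rw [← h.cycle i j hj, ← mul_assoc, h.left i j hj]

theorem x_mul_e (h : IsZigzagSystem e g x) (hn : 1 < n) (i : Fin n) : x i * e i = x i := by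
  obtain ⟨j, hj⟩ := exists_pathGraph_adj hn i
  rw [← h.cycle i j hj, mul_assoc, h.right j i hj.symm]

theorem x_mul_x (h : IsZigzagSystem e g x) (hn : 1 < n) (i : Fin n) : x i * x i = 0 := by
  obtain ⟨j, hj⟩ := exists_pathGraph_adj hn i
  nth_rewrite 2 [← h.cycle i j hj]
  rw [← mul_assoc, h.three i j hj, zero_mul]

theorem g_mul_x (h : IsZigzagSystem e g x) {i j : Fin n}
    (hij : (SimpleGraph.pathGraph n).Adj i j) : g i j * x j = 0 := by
  rw [← h.cycle j i hij.symm, ← mul_assoc, h.cycle i j hij, h.three i j hij]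

theorem mul_mem_zigzagComp (h : IsZigzagSystem e g x) (hn : 1 < n) {i l j : Fin n} {y z : B}
    (hy : y ∈ zigzagComp k e g x i l) (hz : z ∈ zigzagComp k e g x l j) :
    y * z ∈ zigzagComp k e g x i j := by
  suffices hle : zigzagComp k e g x i l * zigzagComp k e g x l j ≤ zigzagComp k e g x i j from
    hle (Submodule.mul_mem_mul hy hz)
  have hsub : ∀ {i j : Fin n} {z : B}, ((i = j ∧ (z = e i ∨ z = x i)) ∨
    ((SimpleGraph.pathGraph n).Adj i j ∧ z = g i j)) → z ∈ zigzagComp k e g x i j :=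
    fun hz => Submodule.subset_span hz
  unfold zigzagComp
  rw [Submodule.span_mul_span, Submodule.span_le]
  rintro _ ⟨y, hy, z, hz, rfl⟩
  change y * z ∈ zigzagComp k e g x i j
  rcases hy with ⟨rfl, rfl | rfl⟩ | ⟨hil, rfl⟩
  · rcases hz with ⟨rfl, rfl | rfl⟩ | ⟨hlj, rfl⟩
    · rw [(h.complete.idem i).eq]
      exact hsub (by simp)
    · rw [h.e_mul_x hn]
      exact hsub (by simp)
    · rw [h.left _ _ hlj]
      exact hsub (by simp [hlj])
  · rcases hz with ⟨rfl, rfl | rfl⟩ | ⟨hlj, rfl⟩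
    · rw [h.x_mul_e hn]
      exact hsub (by simp)
    · rw [h.x_mul_x hn]
      exact zero_mem _
    · rw [h.three _ _ hlj]
      exact zero_mem _
  · rcases hz with ⟨rfl, rfl | rfl⟩ | ⟨hlj, rfl⟩
    · rw [h.right _ _ hil]
      exact hsub (by simp [hil])
    · rw [h.g_mul_x hil]
      exact zero_mem _
    · by_cases hij : i = j
      · subst hij
        rw [h.cycle _ _ hil]
        exact hsub (by simp)
      · rw [h.path _ _ _ hil hlj hij]
        exact zero_mem _

theorem _root_.CompleteOrthogonalIdempotents.sum_mul_mul (h : CompleteOrthogonalIdempotents e) (z : B) :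
    ∑ i, ∑ j, e i * z * e j = z := by
  simp_rw [← Finset.mul_sum, ← Finset.sum_mul, h.complete, one_mul, mul_one]

/-- An algebra generated by the idempotents and arrows of a zig-zag system is spanned by the
elements of the system. -/
theorem mul_mul_mem_zigzagComp (h : IsZigzagSystem e g x) (hn : 1 < n)
    (hgen : Algebra.adjoin k (Set.range e ∪ {z | ∃ i j, (SimpleGraph.pathGraph n).Adj i j ∧
      z = g i j}) = ⊤) (z : B) (i j : Fin n) : e i * z * e j ∈ zigzagComp k e g x i j := by
  have hz : z ∈ Algebra.adjoin k (Set.range e ∪ {z | ∃ i j, (SimpleGraph.pathGraph n).Adj i j ∧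
      z = g i j}) := hgen ▸ Algebra.mem_top
  have he : ∀ i j, e i * e j ∈ zigzagComp k e g x i j := fun i j => by
    by_cases hij : i = j
    · subst hij
      rw [(h.complete.idem i).eq]
      exact Submodule.subset_span (by simp)
    · rw [h.complete.ortho hij]
      exact zero_mem _
  induction hz using Algebra.adjoin_induction generalizing i j with
  | mem z hz =>
    rcases hz with ⟨l, rfl⟩ | ⟨a, b, hab, rfl⟩
    · rw [mul_assoc]
      by_cases hij : i = l
      · subst hij
        rw [← mul_assoc, (h.complete.idem i).eq]
        exact he i j
      · rw [← mul_assoc, h.complete.ortho hij, zero_mul]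
        exact zero_mem _
    · by_cases hia : i = a
      · subst hia
        rw [h.left _ _ hab]
        by_cases hbj : b = j
        · subst hbj
          rw [h.right _ _ hab]
          exact Submodule.subset_span (by simp [hab])
        · rw [← h.right _ _ hab, mul_assoc, h.complete.ortho hbj, mul_zero]
          exact zero_mem _
      · rw [← h.left _ _ hab, ← mul_assoc (e i), h.complete.ortho hia, zero_mul, zero_mul]
        exact zero_mem _
  | algebraMap c =>
    rw [← Algebra.commutes, mul_assoc, ← Algebra.smul_def]
    exact Submodule.smul_mem _ _ (he i j)
  | add y z _ _ hy hz =>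
    rw [mul_add, add_mul]
    exact add_mem (hy i j) (hz i j)
  | mul y z _ _ hy hz =>
    have h1 : e i * (y * z) * e j = ∑ l, (e i * y * e l) * (e l * z * e j) := by
      have h2 : ∀ l, (e i * y * e l) * (e l * z * e j) = e i * y * e l * (z * e j) := fun l => by
        have := (h.complete.idem l).eq
        simp only [mul_assoc]
        rw [← mul_assoc (e l) (e l), this]
      simp_rw [h2, ← Finset.sum_mul, ← Finset.mul_sum, h.complete.complete, mul_one, mul_assoc]
    rw [h1]
    exact sum_mem fun l _ => h.mul_mem_zigzagComp hn (hy i l) (hz l j)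

/-- A homomorphism of algebras is bijective if it maps a generating zig-zag system to a linearly
independent and spanning one. -/
theorem bijective (h : IsZigzagSystem e g x) (hn : 1 < n)
    (hgen : Algebra.adjoin k (Set.range e ∪ {z | ∃ i j, (SimpleGraph.pathGraph n).Adj i j ∧
      z = g i j}) = ⊤)
    {C : Type*} [Ring C] [Algebra k C] {e' : Fin n → C} {g' : Fin n → Fin n → C} {x' : Fin n → C}
    (h' : IsZigzagSystem e' g' x')
    (hspan : ∀ z i j, e' i * z * e' j ∈ zigzagComp k e' g' x' i j)
    (he' : ∀ i, e' i ≠ 0)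
    (hx' : ∀ i : Fin n, i.val + 1 < n → ∀ a b : k, a • e' i + b • x' i = 0 → a = 0 ∧ b = 0)
    (hg' : ∀ i j, (SimpleGraph.pathGraph n).Adj i j → g' i j ≠ 0)
    (φ : B →ₐ[k] C) (hφe : ∀ i, φ (e i) = e' i)
    (hφg : ∀ i j, (SimpleGraph.pathGraph n).Adj i j → φ (g i j) = g' i j) :
    Function.Bijective φ := by
  have hφx : ∀ i, φ (x i) = x' i := fun i => by
    obtain ⟨j, hj⟩ := exists_pathGraph_adj hn i
    rw [← h.cycle i j hj, map_mul, hφg _ _ hj, hφg _ _ hj.symm, h'.cycle i j hj]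
  constructor
  · have key : ∀ i j, ∀ z ∈ zigzagComp k e g x i j, φ z = 0 → z = 0 := by
      intro i j z hz h0
      by_cases hij : i = j
      · subst hij
        have hz' : z ∈ Submodule.span k {e i, x i} := by
          refine Submodule.span_mono ?_ hz
          rintro w (⟨-, hw⟩ | ⟨hw, -⟩)
          · exact hw
          · exact absurd rfl hw.ne
        obtain ⟨a, b, rfl⟩ := Submodule.mem_span_pair.1 hz'
        rw [map_add, map_smul, map_smul, hφe, hφx] at h0
        by_cases hi : i.val + 1 < n
        · obtain ⟨rfl, rfl⟩ := hx' i hi a b h0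
          simp
        · rw [h'.last i (by omega), smul_zero, add_zero] at h0
          rw [(smul_eq_zero.1 h0).resolve_right (he' i), h.last i (by omega)]
          simp
      · have hz' : z ∈ Submodule.span k {w | (SimpleGraph.pathGraph n).Adj i j ∧ w = g i j} := by
          refine Submodule.span_mono ?_ hz
          rintro w (⟨hw, -⟩ | hw)
          · exact absurd hw hij
          · exact hw
        by_cases hadj : (SimpleGraph.pathGraph n).Adj i j
        · simp only [hadj, true_and, Set.ofPred_eq_eq_singleton] at hz'
          obtain ⟨a, rfl⟩ := Submodule.mem_span_singleton.1 hz'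
          rw [map_smul, hφg _ _ hadj] at h0
          rw [(smul_eq_zero.1 h0).resolve_right (hg' i j hadj), zero_smul]
        · simpa [hadj] using hz'
    let _ : Ring B := Algebra.semiringToRing k
    rw [injective_iff_map_eq_zero]
    intro z hz
    rw [← h.complete.sum_mul_mul z]
    refine Finset.sum_eq_zero fun i _ => Finset.sum_eq_zero fun j _ => ?_
    refine key i j _ (h.mul_mul_mem_zigzagComp hn hgen z i j) ?_
    rw [map_mul, map_mul, hz, mul_zero, zero_mul]
  · intro y
    change y ∈ φ.range
    rw [← h'.complete.sum_mul_mul y]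
    refine sum_mem fun i _ => sum_mem fun j _ => ?_
    have hle : zigzagComp k e' g' x' i j ≤ Subalgebra.toSubmodule φ.range := by
      refine Submodule.span_le.2 ?_
      rintro _ (⟨-, rfl | rfl⟩ | ⟨hadj, rfl⟩)
      · exact ⟨e i, hφe i⟩
      · exact ⟨x i, hφx i⟩
      · exact ⟨g i j, hφg i j hadj⟩
    exact hle (hspan y i j)

end IsZigzagSystem

/-! ### The presentation of `B_n` -/

section AlgB

variable (k : Type w) [Field k] (n : ℕ)

/-- The quotient map from the free algebra to `B_n`. -/
noncomputable def AlgB.mk :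
    FreeAlgebra k (PathGen (DoubleQuiver (SimpleGraph.pathGraph n))) →ₐ[k] AlgB k n :=
  ((RingQuot.mkAlgHom k (LeafRel k n)).comp
    (RingQuot.mkAlgHom k (ZigzagRel k (SimpleGraph.pathGraph n)))).comp
    (RingQuot.mkAlgHom k (PathRel k (DoubleQuiver (SimpleGraph.pathGraph n))))

theorem AlgB.mk_surjective : Function.Surjective (AlgB.mk k n) :=
  ((RingQuot.mkAlgHom_surjective k _).comp (RingQuot.mkAlgHom_surjective k _)).comp
    (RingQuot.mkAlgHom_surjective k _)

/-- The trivial paths in `B_n`. -/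
noncomputable def AlgB.vertex (i : Fin n) : AlgB k n :=
  AlgB.mk k n (FreeAlgebra.ι k (.vertex i))

open Classical in
/-- The arrows in `B_n`. The value is zero if there is no arrow from `i` to `j`. -/
noncomputable def AlgB.arrow (i j : Fin n) : AlgB k n :=
  if h : (SimpleGraph.pathGraph n).Adj i j then
    AlgB.mk k n (FreeAlgebra.ι k
      (.arrow (V := DoubleQuiver (SimpleGraph.pathGraph n)) (a := i) (b := j) ⟨h⟩))
  else 0

/-- The loops of length two in `B_n`. -/
noncomputable def AlgB.loop (i : Fin n) : AlgB k n :=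
  if h : i.val + 1 < n then AlgB.arrow k n i ⟨i.val + 1, h⟩ * AlgB.arrow k n ⟨i.val + 1, h⟩ i
  else 0

variable {n}

theorem AlgB.arrow_eq {i j : Fin n} (h : (SimpleGraph.pathGraph n).Adj i j) :
    AlgB.arrow k n i j = AlgB.mk k n (FreeAlgebra.ι k
      (.arrow (V := DoubleQuiver (SimpleGraph.pathGraph n)) (a := i) (b := j) ⟨h⟩)) := by
  rw [AlgB.arrow, dif_pos h]

theorem AlgB.mk_eq_of_pathRel
    {y z : FreeAlgebra k (PathGen (DoubleQuiver (SimpleGraph.pathGraph n)))}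
    (h : PathRel k (DoubleQuiver (SimpleGraph.pathGraph n)) y z) :
    AlgB.mk k n y = AlgB.mk k n z :=
  congrArg (fun t => RingQuot.mkAlgHom k (LeafRel k n)
    (RingQuot.mkAlgHom k (ZigzagRel k (SimpleGraph.pathGraph n)) t)) (RingQuot.mkAlgHom_rel k h)

theorem AlgB.mk_eq_of_zigzagRel
    {y z : PathAlg k (DoubleQuiver (SimpleGraph.pathGraph n))}
    (h : ZigzagRel k (SimpleGraph.pathGraph n) y z) :
    RingQuot.mkAlgHom k (LeafRel k n)
      (RingQuot.mkAlgHom k (ZigzagRel k (SimpleGraph.pathGraph n)) y) =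
    RingQuot.mkAlgHom k (LeafRel k n)
      (RingQuot.mkAlgHom k (ZigzagRel k (SimpleGraph.pathGraph n)) z) :=
  congrArg _ (RingQuot.mkAlgHom_rel k h)

theorem AlgB.arrow_mul_arrow_eq {i j l : Fin n} (hj : (SimpleGraph.pathGraph n).Adj i j)
    (hl : (SimpleGraph.pathGraph n).Adj i l) :
    AlgB.arrow k n i j * AlgB.arrow k n j i = AlgB.arrow k n i l * AlgB.arrow k n l i := by
  rw [arrow_eq k hj, arrow_eq k hj.symm, arrow_eq k hl, arrow_eq k hl.symm]
  have := AlgB.mk_eq_of_zigzagRel k (n := n)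
    (ZigzagRel.cycles (k := k) (a := i) (b := j) (c := l) ⟨hj⟩ ⟨hj.symm⟩ ⟨hl⟩ ⟨hl.symm⟩)
  simp only [map_mul] at this
  exact this

theorem AlgB.arrow_mul_arrow {i j : Fin n} (hij : (SimpleGraph.pathGraph n).Adj i j) :
    AlgB.arrow k n i j * AlgB.arrow k n j i = AlgB.loop k n i := by
  rw [AlgB.loop]
  split_ifs with h
  · exact AlgB.arrow_mul_arrow_eq k hij (SimpleGraph.pathGraph_adj.2 (Or.inl rfl))
  · rw [arrow_eq k hij, arrow_eq k hij.symm]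
    have := RingQuot.mkAlgHom_rel k (LeafRel.loop (k := k) (n := n) (a := i) (b := j)
      (show i.val + 1 = n by omega) ⟨hij⟩ ⟨hij.symm⟩)
    rw [map_mul, map_zero] at this
    exact this

theorem AlgB.isZigzagSystem :
    IsZigzagSystem (AlgB.vertex k n) (AlgB.arrow k n) (AlgB.loop k n) where
  complete :=
    { idem := fun i => by
        have := AlgB.mk_eq_of_pathRel k (n := n) (PathRel.idem (V := DoubleQuiver _) i)
        rwa [map_mul] at this
      ortho := fun i j hij => by
        have := AlgB.mk_eq_of_pathRel k (n := n) (PathRel.ortho (V := DoubleQuiver _) i j hij)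
        rwa [map_mul, map_zero] at this
      complete := by
        have := AlgB.mk_eq_of_pathRel k (n := n) PathRel.sum_eq_one
        rwa [map_sum, map_one] at this }
  left i j h := by
    let f : @Quiver.Hom (DoubleQuiver (SimpleGraph.pathGraph n)) _ i j := ⟨h⟩
    have := AlgB.mk_eq_of_pathRel k (n := n) (PathRel.source f)
    rw [map_mul] at this
    rw [arrow_eq k h]
    exact this
  right i j h := by
    let f : @Quiver.Hom (DoubleQuiver (SimpleGraph.pathGraph n)) _ i j := ⟨h⟩
    have := AlgB.mk_eq_of_pathRel k (n := n) (PathRel.target f)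
    rw [map_mul] at this
    rw [arrow_eq k h]
    exact this
  cycle i j h := AlgB.arrow_mul_arrow k h
  three i j h := by
    rw [← AlgB.arrow_mul_arrow k h, arrow_eq k h, arrow_eq k h.symm]
    have := AlgB.mk_eq_of_zigzagRel k (n := n)
      (ZigzagRel.length_three (k := k) (a := i) (b := j) (c := i) (d := j) ⟨h⟩ ⟨h.symm⟩ ⟨h⟩)
    simp only [map_mul, map_zero] at this
    exact this
  path i j l hij hjl hil := by
    rw [arrow_eq k hij, arrow_eq k hjl]
    have := AlgB.mk_eq_of_zigzagRel k (n := n)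
      (ZigzagRel.not_cycle (k := k) (a := i) (b := j) (c := l) ⟨hij⟩ ⟨hjl⟩ hil)
    simp only [map_mul, map_zero] at this
    exact this
  last i hi := by
    rw [AlgB.loop, dif_neg (by omega)]

theorem AlgB.adjoin_eq_top :
    Algebra.adjoin k (Set.range (AlgB.vertex k n) ∪
      {z | ∃ i j, (SimpleGraph.pathGraph n).Adj i j ∧ z = AlgB.arrow k n i j}) = ⊤ := by
  rw [eq_top_iff]
  rintro z -
  obtain ⟨w, rfl⟩ := AlgB.mk_surjective k n z
  induction w using FreeAlgebra.induction with
  | grade0 c =>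
    rw [AlgHom.commutes]
    exact Subalgebra.algebraMap_mem _ c
  | grade1 p =>
    apply Algebra.subset_adjoin
    cases p with
    | vertex i => exact Or.inl ⟨i, rfl⟩
    | arrow f => exact Or.inr ⟨_, _, f.down, (AlgB.arrow_eq k f.down).symm⟩
  | mul y z hy hz =>
    rw [map_mul]
    exact mul_mem hy hz
  | add y z hy hz =>
    rw [map_add]
    exact add_mem hy hz

/-- The homomorphism from `B_n` defined by a zig-zag system. -/
theorem IsZigzagSystem.exists_algHom {C : Type*} [Ring C] [Algebra k C] {e : Fin n → C}
    {g : Fin n → Fin n → C} {x : Fin n → C} (h : IsZigzagSystem e g x) :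
    ∃ φ : AlgB k n →ₐ[k] C, (∀ i, φ (AlgB.vertex k n i) = e i) ∧
      ∀ i j, (SimpleGraph.pathGraph n).Adj i j → φ (AlgB.arrow k n i j) = g i j := by
  let Q := DoubleQuiver (SimpleGraph.pathGraph n)
  let gen : PathGen Q → C := fun p => match p with
    | .vertex i => e i
    | .arrow (a := i) (b := j) _ => g i j
  let φ₀ := FreeAlgebra.lift k gen
  have hv : ∀ i : Q, φ₀ (FreeAlgebra.ι k (.vertex i)) = e i := fun i =>
    FreeAlgebra.lift_ι_apply _ _
  have ha : ∀ {i j : Q} (f : i ⟶ j), φ₀ (FreeAlgebra.ι k (.arrow f)) = g i j := fun f =>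
    FreeAlgebra.lift_ι_apply _ _
  have h₀ : ∀ ⦃y z⦄, PathRel k Q y z → φ₀ y = φ₀ z := by
    intro y z hyz
    cases hyz with
    | idem i => rw [map_mul, hv, (h.complete.idem i).eq]
    | ortho i j hij => rw [map_mul, hv, hv, map_zero, h.complete.ortho hij]
    | sum_eq_one =>
      rw [map_sum, map_one]
      simp only [hv]
      exact h.complete.complete
    | source f => rw [map_mul, hv, ha, h.left _ _ f.down]
    | target f => rw [map_mul, hv, ha, h.right _ _ f.down]
  let φ₁ := RingQuot.liftAlgHom k ⟨φ₀, h₀⟩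
  have hφ₁ : ∀ {i j : Q} (f : i ⟶ j), φ₁ (PathAlg.arrow k f) = g i j := fun f => by
    simp only [φ₁, PathAlg.arrow, RingQuot.liftAlgHom_mkAlgHom_apply, ha]
  have h₁ : ∀ ⦃y z⦄, ZigzagRel k (SimpleGraph.pathGraph n) y z → φ₁ y = φ₁ z := by
    intro y z hyz
    cases hyz with
    | @length_three a b c d p q r =>
      rw [map_mul, map_mul, hφ₁, hφ₁, hφ₁, map_zero]
      by_cases hac : a = c
      · subst hac
        rw [h.cycle _ _ p.down]
        have := h.three _ _ r.down
        exact this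
      · rw [h.path _ _ _ p.down q.down hac, zero_mul]
    | not_cycle p q hac => rw [map_mul, hφ₁, hφ₁, map_zero, h.path _ _ _ p.down q.down hac]
    | cycles p p' q q' =>
      rw [map_mul, map_mul, hφ₁, hφ₁, hφ₁, hφ₁, h.cycle _ _ p.down, h.cycle _ _ q.down]
  let φ₂ := RingQuot.liftAlgHom k ⟨φ₁, h₁⟩
  have hφ₂ : ∀ {i j : Q} (f : i ⟶ j), φ₂ (ZigzagAlg.arrow k f) = g i j := fun f => by
    simp only [φ₂, ZigzagAlg.arrow, RingQuot.liftAlgHom_mkAlgHom_apply, hφ₁]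
  have h₂ : ∀ ⦃y z⦄, LeafRel k n y z → φ₂ y = φ₂ z := by
    intro y z hyz
    cases hyz with
    | loop hi p q => rw [map_mul, hφ₂, hφ₂, map_zero, h.cycle _ _ p.down, h.last _ hi]
  have hmk : ∀ y, RingQuot.liftAlgHom k ⟨φ₂, h₂⟩ (AlgB.mk k n y) = φ₀ y := fun y => by
    simp only [AlgB.mk, AlgHom.comp_apply, RingQuot.liftAlgHom_mkAlgHom_apply, φ₂, φ₁]
    exact RingQuot.liftAlgHom_mkAlgHom_apply k φ₀ h₀ y
  refine ⟨RingQuot.liftAlgHom k ⟨φ₂, h₂⟩, fun i => ?_, fun i j hij => ?_⟩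
  · rw [AlgB.vertex, hmk]
    exact hv i
  · rw [AlgB.arrow_eq k hij, hmk]
    exact ha _

end AlgB

end Zigzag

/-! ### Algebras with the Cartan matrix of `B_n` -/

section Recognition

variable {k : Type*} [Field k] {Λ : Type*} [Ring Λ] [Algebra k Λ]

theorem mul_mem_peirceComp {e f g x y : Λ} (hx : x ∈ peirceComp k e f)
    (hy : y ∈ peirceComp k f g) : x * y ∈ peirceComp k e g :=
  ⟨by rw [← mul_assoc, hx.1], by rw [mul_assoc, hy.2]⟩

theorem mul_mul_mem_peirceComp {e f : Λ} (he : IsIdempotentElem e) (hf : IsIdempotentElem f)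
    (y : Λ) : e * y * f ∈ peirceComp k e f :=
  ⟨by rw [← mul_assoc, ← mul_assoc, he.eq], by rw [mul_assoc, hf.eq]⟩

theorem Submodule.exists_smul_eq_of_finrank_eq_one_of_mem {V : Type*} [AddCommGroup V] [Module k V]
    {W : Submodule k V} (h : Module.finrank k W = 1) {v w : V} (hv : v ∈ W) (hv0 : v ≠ 0)
    (hw : w ∈ W) : ∃ c : k, c • v = w := by
  obtain ⟨c, hc⟩ := (finrank_eq_one_iff_of_nonzero' (⟨v, hv⟩ : W)
    fun h => hv0 (congrArg Subtype.val h)).1 h ⟨w, hw⟩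
  exact ⟨c, congrArg Subtype.val hc⟩

theorem eq_zero_of_smul_add_smul_eq_zero {e x : Λ} (hex : e * x = x) (hx0 : x ≠ 0)
    (hxx : x * x = 0) {a b : k} (h : a • e + b • x = 0) : a = 0 ∧ b = 0 := by
  have h1 : a • x = 0 := by
    have := congrArg (· * x) h
    simpa [add_mul, hex, hxx] using this
  have ha : a = 0 := (smul_eq_zero.1 h1).resolve_right hx0
  rw [ha, zero_smul, zero_add] at h
  exact ⟨ha, (smul_eq_zero.1 h).resolve_right hx0⟩

theorem exists_smul_add_smul_eq [Module.Finite k Λ] {e x : Λ} (he : IsIdempotentElem e)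
    (hdim : Module.finrank k (peirceComp k e e) = 2) (hx : x ∈ peirceComp k e e) (hx0 : x ≠ 0)
    (hxx : x * x = 0) {y : Λ} (hy : y ∈ peirceComp k e e) : ∃ a b : k, a • e + b • x = y := by
  let v : Fin 2 → peirceComp k e e := ![⟨e, he.eq, he.eq⟩, ⟨x, hx⟩]
  have hli : LinearIndependent k v := by
    rw [LinearIndependent.pair_iff]
    intro a b hab
    exact eq_zero_of_smul_add_smul_eq_zero hx.1 hx0 hxx (congrArg Subtype.val hab)
  have hspan := hli.span_eq_top_of_card_eq_finrank' (by simp [hdim])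
  have hmem : (⟨y, hy⟩ : peirceComp k e e) ∈ Submodule.span k (Set.range v) := by
    rw [hspan]
    exact Submodule.mem_top
  rw [Matrix.range_cons_cons_empty] at hmem
  obtain ⟨a, b, hab⟩ := Submodule.mem_span_pair.1 hmem
  exact ⟨a, b, congrArg Subtype.val hab⟩

/-- Let `e` be a primitive idempotent, and let `a ∈ e Λ f` and `b ∈ f Λ e`, where `e Λ e` has
larger dimension than `e Λ f = k a`. Then `a b a = μ a` for a scalar `μ`. If `μ` did not vanish,
then `a b` would be `μ` times an idempotent, hence equal to `μ e`, and `e Λ e` would embed in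
`e Λ f`. -/
theorem IsPrimitiveIdem.mul_mul_eq_zero [Module.Finite k Λ] {e f a b : Λ}
    (he : IsPrimitiveIdem e) (hef : Module.finrank k (peirceComp k e f) = 1)
    (hee : Module.finrank k (peirceComp k e e) ≠ 1) (ha : a ∈ peirceComp k e f)
    (hb : b ∈ peirceComp k f e) (hab0 : a * b ≠ 0) : a * b * a = 0 := by
  have ha0 : a ≠ 0 := fun h => hab0 (by rw [h, zero_mul])
  have hx : a * b ∈ peirceComp k e e := mul_mem_peirceComp ha hb
  obtain ⟨μ, hμ⟩ := Submodule.exists_smul_eq_of_finrank_eq_one_of_mem hef ha ha0 (mul_mem_peirceComp hx ha)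
  by_cases hμ0 : μ = 0
  · rw [← hμ, hμ0, zero_smul]
  exfalso
  set x := a * b with hxdef
  have hxx : x * x = μ • x := by
    nth_rewrite 2 [hxdef]
    rw [← mul_assoc, ← hμ, smul_mul_assoc]
  have hy : IsIdempotentElem (μ⁻¹ • x) := by
    rw [IsIdempotentElem, smul_mul_smul_comm, hxx, smul_smul, mul_assoc, inv_mul_cancel₀ hμ0,
      mul_one]
  have hye : e * (μ⁻¹ • x) = μ⁻¹ • x := by rw [mul_smul_comm, hx.1]
  have hye' : (μ⁻¹ • x) * e = μ⁻¹ • x := by rw [smul_mul_assoc, hx.2]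
  rcases he.2.2 (μ⁻¹ • x) (e - μ⁻¹ • x) hy (by
      rw [IsIdempotentElem, mul_sub, sub_mul, sub_mul, he.1.eq, hye, hye', hy.eq]
      abel) (by rw [mul_sub, hye', hy.eq, sub_self]) (by rw [sub_mul, hye, hy.eq, sub_self])
    (by abel) with h0 | h0
  · exact hab0 ((smul_eq_zero.1 h0).resolve_left (inv_ne_zero hμ0))
  · have hxe : x = μ • e := by
      rw [sub_eq_zero.1 h0, smul_smul, mul_inv_cancel₀ hμ0, one_smul]
    -- Right multiplication by `a` embeds `e Λ e` in `e Λ f`, since `a b` is a unit in `e Λ e`.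
    have hle : Module.finrank k (peirceComp k e e) ≤ Module.finrank k (peirceComp k e f) := by
      let φ : peirceComp k e e →ₗ[k] peirceComp k e f :=
        ((LinearMap.mulRight k a).comp (peirceComp k e e).subtype).codRestrict _
          fun z => mul_mem_peirceComp z.2 ha
      refine LinearMap.finrank_le_finrank_of_injective (f := φ) ?_
      rw [injective_iff_map_eq_zero]
      intro z hz
      have hz' : (z : Λ) * a = 0 := congrArg Subtype.val hz
      have : μ • (z : Λ) = 0 := by
        rw [← z.2.2, ← mul_smul_comm, ← hxe, hxdef, ← mul_assoc, hz', zero_mul]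
      exact Subtype.ext ((smul_eq_zero.1 this).resolve_left hμ0)
    have hpos : 0 < Module.finrank k (peirceComp k e e) := by
      have : Nontrivial (peirceComp k e e) :=
        ⟨⟨⟨e, he.1.eq, he.1.eq⟩, 0, fun h => he.2.1 (congrArg Subtype.val h)⟩⟩
      exact Module.finrank_pos
    omega

/-- Numbers `s i` that turn given ratios `c i` of consecutive numbers into equalities. -/
theorem exists_rescaling (c : ℕ → k) (hc : ∀ i, c i ≠ 0) :
    ∃ s : ℕ → k, (∀ i, s i ≠ 0) ∧ ∀ i, s (i + 1) = s i * c i := by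
  refine ⟨fun i => ∏ j ∈ Finset.range i, c j, fun i => Finset.prod_ne_zero_iff.2 fun j _ => hc j,
    fun i => Finset.prod_range_succ _ _⟩

variable {n : ℕ} {e : Fin n → Λ}

/-- An algebra whose Cartan matrix is that of `B_n`, and whose projective modules except for the
last one have simple socles, is isomorphic to `B_n`. -/
theorem nonempty_algEquiv_algB {k : Type w} [Field k] [Algebra k Λ] [Module.Finite k Λ]
    (hn : 1 < n) (he : CompleteOrthogonalIdempotents e) (hprim : ∀ i, IsPrimitiveIdem (e i))
    (hdim : ∀ i j, Module.finrank k (peirceComp k (e i) (e j)) =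
      if i = j then (if i.val + 1 < n then 2 else 1)
      else if i.val + 1 = j.val ∨ j.val + 1 = i.val then 1 else 0)
    (hsoc : ∀ i : Fin n, i.val + 1 < n → ∀ x, e i * x = x → x ≠ 0 → ∃ y, x * y * e i ≠ 0) :
    Nonempty (Λ ≃ₐ[k] AlgB k n) := by
  have hdim1 : ∀ i j, (SimpleGraph.pathGraph n).Adj i j →
      Module.finrank k (peirceComp k (e i) (e j)) = 1 := fun i j hij => by
    rw [hdim, if_neg hij.ne, if_pos (SimpleGraph.pathGraph_adj.1 hij)]
  have hdim2 : ∀ i : Fin n, i.val + 1 < n →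
      Module.finrank k (peirceComp k (e i) (e i)) = 2 := fun i hi => by
    rw [hdim, if_pos rfl, if_pos hi]
  have hself : ∀ i, e i ∈ peirceComp k (e i) (e i) := fun i =>
    ⟨(he.idem i).eq, (he.idem i).eq⟩
  -- Paths that go back and forth do not vanish, except at the last vertex.
  have hne : ∀ i j : Fin n, i.val + 1 < n → (SimpleGraph.pathGraph n).Adj i j → ∀ a b,
      a ∈ peirceComp k (e i) (e j) → b ∈ peirceComp k (e j) (e i) → a ≠ 0 → b ≠ 0 →
      a * b ≠ 0 := by
    intro i j hi hij a b ha hb ha0 hb0 hab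
    obtain ⟨y, hy⟩ := hsoc i hi a ha.1 ha0
    obtain ⟨c, hc⟩ := Submodule.exists_smul_eq_of_finrank_eq_one_of_mem (hdim1 j i hij.symm) hb hb0
      (mul_mul_mem_peirceComp (he.idem j) (he.idem i) y)
    refine hy ?_
    rw [← ha.2, mul_assoc a, mul_assoc a, ← hc, mul_smul_comm, hab, smul_zero]
  have hthree : ∀ i j : Fin n, i.val + 1 < n → (SimpleGraph.pathGraph n).Adj i j → ∀ a b,
      a ∈ peirceComp k (e i) (e j) → b ∈ peirceComp k (e j) (e i) → a ≠ 0 → b ≠ 0 →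
      a * b * a = 0 ∧ b * a * b = 0 := by
    intro i j hi hij a b ha hb ha0 hb0
    have hab := hne i j hi hij a b ha hb ha0 hb0
    have h1 : a * b * a = 0 := (hprim i).mul_mul_eq_zero (hdim1 i j hij)
      (by rw [hdim2 i hi]; omega) ha hb hab
    refine ⟨h1, ?_⟩
    obtain ⟨c, hc⟩ := Submodule.exists_smul_eq_of_finrank_eq_one_of_mem (hdim1 j i hij.symm) hb hb0
      (mul_mem_peirceComp (mul_mem_peirceComp hb ha) hb)
    have h2 : c • (a * b) = 0 := by
      rw [← mul_smul_comm, hc, ← mul_assoc, ← mul_assoc, h1, zero_mul]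
    rw [← hc, (smul_eq_zero.1 h2).resolve_right hab, zero_smul]
  -- Arbitrary generators of the one-dimensional Peirce components.
  have hex : ∀ i j, ∃ a, (SimpleGraph.pathGraph n).Adj i j →
      a ∈ peirceComp k (e i) (e j) ∧ a ≠ 0 := by
    intro i j
    by_cases hij : (SimpleGraph.pathGraph n).Adj i j
    · have : Nontrivial (peirceComp k (e i) (e j)) :=
        Module.nontrivial_of_finrank_pos (R := k) (by rw [hdim1 i j hij]; omega)
      obtain ⟨a, ha⟩ := exists_ne (0 : peirceComp k (e i) (e j))
      exact ⟨a, fun _ => ⟨a.2, fun h => ha (Subtype.ext h)⟩⟩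
    · exact ⟨0, fun h => absurd h hij⟩
  choose g₀ hg₀ using hex
  -- The two loops of length two at an inner vertex are proportional, since both square to zero.
  have hratio : ∀ i : ℕ, ∃ c : k, c ≠ 0 ∧ ∀ h : i + 2 < n,
      g₀ ⟨i + 1, by omega⟩ ⟨i, by omega⟩ * g₀ ⟨i, by omega⟩ ⟨i + 1, by omega⟩ =
        c • (g₀ ⟨i + 1, by omega⟩ ⟨i + 2, h⟩ * g₀ ⟨i + 2, h⟩ ⟨i + 1, by omega⟩) := by
    intro i
    by_cases h : i + 2 < n
    · set l : Fin n := ⟨i, by omega⟩ with hl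
      set m : Fin n := ⟨i + 1, by omega⟩ with hm
      set r : Fin n := ⟨i + 2, h⟩ with hr
      have hmi : m.val + 1 < n := h
      have hml : (SimpleGraph.pathGraph n).Adj m l :=
        SimpleGraph.pathGraph_adj.2 (Or.inr rfl)
      have hmr : (SimpleGraph.pathGraph n).Adj m r :=
        SimpleGraph.pathGraph_adj.2 (Or.inl rfl)
      have hprod : ∀ j, (SimpleGraph.pathGraph n).Adj m j →
          g₀ m j * g₀ j m ∈ peirceComp k (e m) (e m) ∧ g₀ m j * g₀ j m ≠ 0 ∧
          (g₀ m j * g₀ j m) * (g₀ m j * g₀ j m) = 0 := by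
        intro j hj
        obtain ⟨ha, ha0⟩ := hg₀ m j hj
        obtain ⟨hb, hb0⟩ := hg₀ j m hj.symm
        refine ⟨mul_mem_peirceComp ha hb, hne m j hmi hj _ _ ha hb ha0 hb0, ?_⟩
        rw [← mul_assoc, (hthree m j hmi hj _ _ ha hb ha0 hb0).1, zero_mul]
      obtain ⟨hx, hx0, hxx⟩ := hprod r hmr
      obtain ⟨hy, hy0, hyy⟩ := hprod l hml
      obtain ⟨a, b, hab⟩ := exists_smul_add_smul_eq (he.idem m) (hdim2 m hmi) hx hx0 hxx hy
      have ha : a = 0 := by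
        have h1 : (a * a) • e m + (2 * a * b) • (g₀ m r * g₀ r m) = 0 := by
          rw [← hyy, ← hab, mul_add, add_mul, add_mul, smul_mul_smul_comm, smul_mul_smul_comm,
            smul_mul_smul_comm, smul_mul_smul_comm, (he.idem m).eq, hx.1, hx.2, hxx, smul_zero,
            add_zero, add_assoc, ← add_smul]
          congr 2
          ring
        exact mul_self_eq_zero.1 (eq_zero_of_smul_add_smul_eq_zero hx.1 hx0 hxx h1).1
      rw [ha, zero_smul, zero_add] at hab
      refine ⟨b, fun hb => hy0 ?_, fun _ => hab.symm⟩
      rw [← hab, hb, zero_smul]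
    · exact ⟨1, one_ne_zero, fun h' => absurd h' h⟩
  choose c hc0 hc using hratio
  obtain ⟨s, hs0, hs⟩ := exists_rescaling c hc0
  -- Only the arrows that decrease the vertex are rescaled.
  let g : Fin n → Fin n → Λ := fun i j => if i.val + 1 = j.val then g₀ i j else s j.val • g₀ i j
  have hg : ∀ i j, (SimpleGraph.pathGraph n).Adj i j →
      g i j ∈ peirceComp k (e i) (e j) ∧ g i j ≠ 0 := by
    intro i j hij
    simp only [g]
    split_ifs
    · exact hg₀ i j hij
    · exact ⟨Submodule.smul_mem _ _ (hg₀ i j hij).1, smul_ne_zero (hs0 _) (hg₀ i j hij).2⟩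
  let x : Fin n → Λ := fun i =>
    if h : i.val + 1 < n then g i ⟨i.val + 1, h⟩ * g ⟨i.val + 1, h⟩ i else 0
  have hlast : ∀ i j, (SimpleGraph.pathGraph n).Adj i j → ¬ i.val + 1 < n →
      g i j * g j i = 0 := by
    intro i j hij hi
    have hj : j.val + 1 < n := by
      rcases SimpleGraph.pathGraph_adj.1 hij with h | h <;> omega
    obtain ⟨ha, ha0⟩ := hg i j hij
    obtain ⟨hb, hb0⟩ := hg j i hij.symm
    have h1 : Module.finrank k (peirceComp k (e i) (e i)) = 1 := by
      rw [hdim, if_pos rfl, if_neg hi]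
    obtain ⟨t, ht⟩ := Submodule.exists_smul_eq_of_finrank_eq_one_of_mem h1 (hself i) (hprim i).2.1
      (mul_mem_peirceComp ha hb)
    have h2 := (hthree j i hj hij.symm _ _ hb ha hb0 ha0).2
    rw [← ht, smul_mul_assoc, ha.1] at h2
    rw [← ht, (smul_eq_zero.1 h2).resolve_right ha0, zero_smul]
  have hcycle : ∀ i j, (SimpleGraph.pathGraph n).Adj i j → g i j * g j i = x i := by
    intro i j hij
    by_cases hi : i.val + 1 < n
    · simp only [x, dif_pos hi]
      rcases SimpleGraph.pathGraph_adj.1 hij with h | h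
      · have hj : j = ⟨i.val + 1, hi⟩ := Fin.ext h.symm
        rw [hj]
      · obtain ⟨i, hin⟩ := i
        obtain ⟨j, hjn⟩ := j
        simp only at h hi
        subst h
        simp only [g, if_true, show ¬ (j + 1 + 1 = j) by omega,
          show ¬ (j + 1 + 1 + 1 = j + 1) by omega, if_false]
        rw [smul_mul_assoc, hc j hi, smul_smul, mul_smul_comm, hs]
    · simp only [x, dif_neg hi]
      exact hlast i j hij hi
  have hsys : IsZigzagSystem e g x :=
    { complete := he
      left := fun i j hij => (hg i j hij).1.1
      right := fun i j hij => (hg i j hij).1.2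
      cycle := hcycle
      three := fun i j hij => by
        rw [← hcycle i j hij]
        by_cases hi : i.val + 1 < n
        · exact (hthree i j hi hij _ _ (hg i j hij).1 (hg j i hij.symm).1 (hg i j hij).2
            (hg j i hij.symm).2).1
        · rw [hlast i j hij hi, zero_mul]
      path := fun i j l hij hjl hil => by
        have h0 : Module.finrank k (peirceComp k (e i) (e l)) = 0 := by
          rw [hdim, if_neg hil, if_neg]
          have := Fin.val_ne_of_ne hil
          rcases SimpleGraph.pathGraph_adj.1 hij with h | h <;>
            rcases SimpleGraph.pathGraph_adj.1 hjl with h' | h' <;> omega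
        have h1 := Submodule.finrank_eq_zero.1 h0
        have h2 := mul_mem_peirceComp (hg i j hij).1 (hg j l hjl).1
        rwa [h1, Submodule.mem_bot] at h2
      last := fun i hi => by simp only [x, dif_neg (show ¬ i.val + 1 < n by omega)] }
  have hxne : ∀ i : Fin n, i.val + 1 < n → x i ≠ 0 := fun i hi => by
    obtain ⟨j, hij⟩ := exists_pathGraph_adj hn i
    rw [← hcycle i j hij]
    exact hne i j hi hij _ _ (hg i j hij).1 (hg j i hij.symm).1 (hg i j hij).2
      (hg j i hij.symm).2
  have hxmem : ∀ i, x i ∈ peirceComp k (e i) (e i) := fun i =>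
    ⟨hsys.e_mul_x hn i, hsys.x_mul_e hn i⟩
  have hspan : ∀ z i j, e i * z * e j ∈ zigzagComp k e g x i j := by
    intro z i j
    have hz : e i * z * e j ∈ peirceComp k (e i) (e j) :=
      mul_mul_mem_peirceComp (he.idem i) (he.idem j) z
    by_cases hij : i = j
    · subst hij
      have hei : e i ∈ zigzagComp k e g x i i := Submodule.subset_span (by simp)
      have hxi : x i ∈ zigzagComp k e g x i i := Submodule.subset_span (by simp)
      by_cases hi : i.val + 1 < n
      · obtain ⟨a, b, hab⟩ := exists_smul_add_smul_eq (he.idem i) (hdim2 i hi) (hxmem i)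
          (hxne i hi) (hsys.x_mul_x hn i) hz
        rw [← hab]
        exact add_mem (Submodule.smul_mem _ _ hei) (Submodule.smul_mem _ _ hxi)
      · have h1 : Module.finrank k (peirceComp k (e i) (e i)) = 1 := by
          rw [hdim, if_pos rfl, if_neg hi]
        obtain ⟨t, ht⟩ := Submodule.exists_smul_eq_of_finrank_eq_one_of_mem h1 (hself i) (hprim i).2.1 hz
        rw [← ht]
        exact Submodule.smul_mem _ _ hei
    · by_cases hadj : (SimpleGraph.pathGraph n).Adj i j
      · obtain ⟨t, ht⟩ := Submodule.exists_smul_eq_of_finrank_eq_one_of_mem (hdim1 i j hadj) (hg i j hadj).1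
          (hg i j hadj).2 hz
        rw [← ht]
        exact Submodule.smul_mem _ _ (Submodule.subset_span (by simp [hadj]))
      · have h0 : Module.finrank k (peirceComp k (e i) (e j)) = 0 := by
          rw [hdim, if_neg hij, if_neg (fun h => hadj (SimpleGraph.pathGraph_adj.2 h))]
        rw [Submodule.finrank_eq_zero.1 h0, Submodule.mem_bot] at hz
        rw [hz]
        exact zero_mem _
  obtain ⟨φ, hφe, hφg⟩ := hsys.exists_algHom k
  have hbij := (AlgB.isZigzagSystem k (n := n)).bijective hn (AlgB.adjoin_eq_top k) hsys hspan
    (fun i => (hprim i).2.1) (fun i hi a b hab => eq_zero_of_smul_add_smul_eq_zero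
      (hsys.e_mul_x hn i) (hxne i hi) (hsys.x_mul_x hn i) hab)
    (fun i j hij => (hg i j hij).2) φ hφe hφg
  exact ⟨(AlgEquiv.ofBijective φ hbij).symm⟩

end Recognition

/-! ### The classification -/

section Classification

/-- If there is only one simple module, then the algebra is simple as a module over itself, so that
its projective module is injective. -/
theorem injective_of_unique (k : Type*) [Field k] [IsAlgClosed k] {Λ : Type u} [Ring Λ]
    [Algebra k Λ] [Module.Finite k Λ] [Module.Finite k Λᵐᵒᵖ] [IsArtinianRing Λᵐᵒᵖ] {n : ℕ}
    {L P : Fin n → ModuleCat.{u} Λᵐᵒᵖ} (hn : n = 1) (hL : IsFullSetOfSimples L)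
    (hP : ∀ i, IsProjectiveCover (P i) (L i)) (hqh : IsQuasiHereditary L P) {e : Fin n → Λ}
    (he : CompleteOrthogonalIdempotents e) (i : Fin n) (a : rightIdeal (e i) ≃ₗ[Λᵐᵒᵖ] P i) :
    Module.Injective Λᵐᵒᵖ (P i) := by
  subst hn
  have := hL.simple i
  have := (hP i).finite
  have := (hP i).1
  obtain ⟨-, p, hp, -⟩ := hP i
  have hker : LinearMap.ker p = ⊥ := by
    by_contra hne
    have : Nontrivial (LinearMap.ker p) := Submodule.nontrivial_iff_ne_bot.2 hne
    obtain ⟨t, q, hq⟩ := hL.exists_surjective (LinearMap.ker p)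
    obtain rfl : t = i := Subsingleton.elim _ _
    have h1 := homDim_last k hL hP hqh (i := t) (by omega)
    rw [homDim_quotient_add k (LinearMap.ker p),
      homDim_quotient_add k (B := LinearMap.ker p) (LinearMap.ker q),
      homDim_congr_right k (p.quotKerEquivOfSurjective hp),
      homDim_congr_right k (q.quotKerEquivOfSurjective hq), homDim_projectiveCover k hL hP,
      if_pos rfl] at h1
    omega
  have b := LinearEquiv.ofBijective p ⟨LinearMap.ker_eq_bot.1 hker, hp⟩
  have he1 : e i = 1 := by
    have := he.complete
    rwa [Fintype.sum_subsingleton _ i] at this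
  have htop : rightIdeal (e i) = ⊤ := by
    rw [eq_top_iff]
    exact fun x _ => mem_rightIdeal.2 ⟨x, by rw [he1, one_mul]⟩
  have c : Λᵐᵒᵖ ≃ₗ[Λᵐᵒᵖ] L i := (opLinearEquivSelf Λ).trans
    (Submodule.topEquiv.symm.trans ((LinearEquiv.ofEq _ _ htop.symm).trans (a.trans b)))
  have : IsSimpleModule Λᵐᵒᵖ Λᵐᵒᵖ := IsSimpleModule.congr c
  have : IsSemisimpleRing Λᵐᵒᵖ := inferInstanceAs (IsSemisimpleModule Λᵐᵒᵖ Λᵐᵒᵖ)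
  exact Module.injective_of_isSemisimpleRing _ _

end Classification

/-- Modules are right modules, that is, modules over `Λᵐᵒᵖ`. -/
theorem theorem2 {k : Type w} [Field k] [IsAlgClosed k]
    {Λ : Type u} [Ring Λ] [Algebra k Λ] [Module.Finite k Λ]
    (hbasic : IsBasicAlg Λ) (hconn : IsConnectedAlg Λ)
    {n : ℕ} (hn : 0 < n) (L P : Fin n → ModuleCat.{u} Λᵐᵒᵖ)
    (hL : IsFullSetOfSimples L) (hP : ∀ i, IsProjectiveCover (P i) (L i))
    (hqh : IsQuasiHereditary L P)
    (hinj : {i | Module.Injective Λᵐᵒᵖ (P i)}.ncard = n - 1)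
    (hdual : HasSimplePreservingDuality Λᵐᵒᵖ) :
    1 < n ∧ Nonempty (Λ ≃ₐ[k] AlgB k n) := by
  have : Module.Finite k Λᵐᵒᵖ := Module.Finite.equiv (MulOpposite.opLinearEquiv k)
  have : IsArtinianRing Λᵐᵒᵖ := IsArtinianRing.of_finite k Λᵐᵒᵖ
  obtain ⟨e, he, hprim, hiso⟩ := hbasic.exists_idempotents k hL hP
  have hsymm : ∀ i j, homDim k Λᵐᵒᵖ (P i) (P j) = homDim k Λᵐᵒᵖ (P j) (P i) :=
    cartan_symm k hL hP hdual
  have hcorner : ∀ i j, Module.finrank k (peirceComp k (e i) (e j)) =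
      homDim k Λᵐᵒᵖ (P i) (P j) := fun i j => by
    obtain ⟨a⟩ := hiso i
    obtain ⟨b⟩ := hiso j
    rw [finrank_peirceComp k (he.idem i) (he.idem j), homDim_congr k b a, hsymm]
  have hn1 : 1 < n := by
    by_contra hn1
    have hn1 : n = 1 := by omega
    have huniv : {i | Module.Injective Λᵐᵒᵖ (P i)} = Set.univ :=
      Set.eq_univ_of_forall fun i => injective_of_unique k hn1 hL hP hqh he i (hiso i).some
    rw [huniv, Set.ncard_univ, Nat.card_eq_fintype_card, Fintype.card_fin] at hinj
    omega
  -- An injective `P i` with `L i` of multiplicity one is simple, and splits off from `Λ`.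
  have htwo : ∀ i, Module.Injective Λᵐᵒᵖ (P i) → homDim k Λᵐᵒᵖ (P i) (P i) ≠ 1 := by
    intro i hi hone
    have hzero : ∀ j, j ≠ i → ∀ y, e i * y * e j = 0 ∧ e j * y * e i = 0 := by
      intro j hji y
      have h1 := homDim_eq_zero_of_hasSimpleSocle k hL hP
        (hasSimpleSocle_of_injective k hL hP hqh hsymm hi) hone hji
      have h2 := Submodule.finrank_eq_zero.1 ((hcorner j i).trans h1)
      have h3 := Submodule.finrank_eq_zero.1 ((hcorner i j).trans ((hsymm i j).trans h1))
      have h4 := mul_mul_mem_peirceComp (k := k) (he.idem i) (he.idem j) y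
      have h5 := mul_mul_mem_peirceComp (k := k) (he.idem j) (he.idem i) y
      rw [h3, Submodule.mem_bot] at h4
      rw [h2, Submodule.mem_bot] at h5
      exact ⟨h4, h5⟩
    have hcentral : ∀ y, e i * y = y * e i := by
      intro y
      have h1 : e i * y = e i * y * e i := by
        conv_lhs => rw [← mul_one (e i * y), ← he.complete, Finset.mul_sum]
        exact Finset.sum_eq_single i (fun j _ hj => (hzero j hj y).1) (by simp)
      have h2 : y * e i = e i * y * e i := by
        conv_lhs => rw [← one_mul (y * e i), ← he.complete, Finset.sum_mul]
        simp only [← mul_assoc]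
        exact Finset.sum_eq_single i (fun j _ hj => (hzero j hj y).2) (by simp)
      rw [h1, h2]
    rcases hconn.2 (e i) (he.idem i) hcentral with h | h
    · exact (hprim i).2.1 h
    · have : Nontrivial (Fin n) := Fin.nontrivial_iff_two_le.2 hn1
      obtain ⟨j, hj⟩ := exists_ne i
      have h1 := he.ortho hj
      simp only at h1
      rw [h, mul_one] at h1
      exact (hprim j).2.1 h1
  -- The last projective module is not injective, hence all other ones are.
  have hinj' : ∀ i : Fin n, i.val + 1 < n → Module.Injective Λᵐᵒᵖ (P i) := by
    let l : Fin n := ⟨n - 1, by omega⟩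
    have hl : ¬ Module.Injective Λᵐᵒᵖ (P l) := fun h =>
      htwo l h (homDim_last k hL hP hqh (by simp only [l]; omega))
    have hsub : {i | Module.Injective Λᵐᵒᵖ (P i)} ⊆ {l}ᶜ := by
      rintro i hi rfl
      exact hl hi
    have heq := Set.eq_of_subset_of_ncard_le hsub (by
      rw [hinj, Set.ncard_compl, Set.ncard_singleton, Nat.card_eq_fintype_card, Fintype.card_fin])
    intro i hi
    have : i ∈ ({l}ᶜ : Set (Fin n)) := fun h => by
      have := congrArg Fin.val h
      simp only [l] at this
      omega
    rwa [← heq] at this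
  have hsoc : ∀ i : Fin n, i.val + 1 < n → HasSimpleSocle Λᵐᵒᵖ (L i) (P i) := fun i hi =>
    hasSimpleSocle_of_injective k hL hP hqh hsymm (hinj' i hi)
  refine ⟨hn1, nonempty_algEquiv_algB hn1 he hprim (fun i j => ?_) fun i hi x hx hx0 => ?_⟩
  · rw [hcorner, cartan_eq k hL hP hqh hsymm hsoc (fun i hi => htwo i (hinj' i hi))]
  · have := hL.simple i
    obtain ⟨a⟩ := hiso i
    exact (hsoc i hi).exists_mul_ne_zero (hP i) (he.idem i) a hx hx0
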